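/- Let $H$ be a complex Hilbert space, let $\mathcal N\subseteq B(H)$ be a von Neumann algebra with a faithful normal semi-finite trace $\tau$, and fix $0<q<\infty$. For $A\in\mathcal N$ put $\mu(t,A)=\inf\{\|Ap\|:\ p\in\mathcal N \text{ a projection},\ \tau(1-p)\le t\}$ and $$\mathcal M_{1,\infty}=\Big\{A\in\mathcal N:\ \sup_{t>0}\frac1{\log(1+t)}\int_0^t\mu(s,A)\,ds<\infty\Big\}.$$ Let $L_\infty(0,\infty)$ be the space of bounded Lebesgue measurable real functions on $(0,\infty)$. A *generalised limit* is a positive linear functional $\gamma:L_\infty(0,\infty)\to\mathbb R$ with $\gamma(1)=1$ and $\gamma(z)=0$ whenever $\lim_{t\to\infty}z(t)=0$; it is *dilation invariant* if $\gamma(\sigma_sz)=\gamma(z)$ for all $s>0$ and all $z$, where $(\sigma_sz)(t)=z(t/s)$. Put $(Mx)(t)=\frac1{\log t}\int_1^tx(s)\frac{ds}{s}$, and for $0\le A\in\mathcal M_{1,\infty}$ and a generalised limit $\gamma$ put $$\xi_\gamma(A)=(\gamma\circ M)\Big(t\mapsto\tfrac1t\,\tau\big(\exp(-(tA)^{-q})\big)\Big),$$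 where $\exp(-(tA)^{-q})$ is $f(tA)$ for the function $f(x)=\exp(-x^{-q})$ $(x>0)$, $f(0)=0$. For arbitrary $A\in\mathcal M_{1,\infty}$ put $$\xi_\gamma(A)=\xi_\gamma(\Re(A)_+)-\xi_\gamma(\Re(A)_-)+i\big(\xi_\gamma(\Im(A)_+)-\xi_\gamma(\Im(A)_-)\big).$$ Then $\xi_\gamma$ is well defined: for $0\le A\in\mathcal M_{1,\infty}$ one has $\tau(\exp(-(tA)^{-q}))<\infty$ for all $t>0$, and $M\big(t\mapsto\frac1t\tau(\exp(-(tA)^{-q}))\big)\in L_\infty(0,\infty)$ (any value is allowed at the single point $t=1$). If $\gamma$ is a generalised limit for which $\xi_\gamma$ is a linear functional on $\mathcal M_{1,\infty}$, then there exists a dilation invariant generalised limit $\omega$ with $\xi_\gamma(A)=\xi_\omega(A)$ for all $A\in\mathcal M_{1,\infty}$; moreover $\omega$ can be chosen to take equal values on almost everywhere equal functions, so that the assertion holds whether the elements of $L_\infty(0,\infty)$ are regarded as functions or as almost everywhere equivalence classes. -/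

import Mathlib

open MeasureTheory Filter Topology Set
open scoped ENNReal NNReal ComplexStarModule

noncomputable section

namespace HeatKernel

/-! ### Bounded measurable functions on the semi-axis and generalised limits -/

/-- The semi-axis `(0, ∞)`. -/
abbrev SemiAxis : Type := {t : ℝ // 0 < t}

/-- Lebesgue measure on the semi-axis. -/
def lebesgue : Measure SemiAxis := Measure.comap Subtype.val (volume : Measure ℝ)

/-- `L_∞(0, ∞)`: the bounded Lebesgue measurable real functions on `(0, ∞)`.
(Almost everywhere measurable with respect to the Borel sigma-algebra is the same as
measurable with respect to the Lebesgue sigma-algebra.) -/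
def LInfty : Submodule ℝ (SemiAxis → ℝ) where
  carrier := {x | AEMeasurable x lebesgue ∧ ∃ C : ℝ, ∀ t, |x t| ≤ C}
  zero_mem' := ⟨aemeasurable_const, 0, fun t => by simp⟩
  add_mem' := by
    rintro x y ⟨hx, C, hC⟩ ⟨hy, D, hD⟩
    exact ⟨hx.add hy, C + D, fun t => (abs_add_le _ _).trans (add_le_add (hC t) (hD t))⟩
  smul_mem' := by
    rintro c x ⟨hx, C, hC⟩
    refine ⟨hx.const_smul c, |c| * C, fun t => ?_⟩
    change |c • x t| ≤ _
    rw [smul_eq_mul, abs_mul]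
    exact mul_le_mul_of_nonneg_left (hC t) (abs_nonneg c)

/-- The map `t ↦ t / s` of the semi-axis, for `s > 0`. -/
def scale (s : ℝ) (hs : 0 < s) (t : SemiAxis) : SemiAxis := ⟨t.1 / s, div_pos t.2 hs⟩

theorem quasiMeasurePreserving_scale (s : ℝ) (hs : 0 < s) :
    Measure.QuasiMeasurePreserving (scale s hs) lebesgue lebesgue := by
  have hm : Measurable (scale s hs) := (measurable_subtype_coe.div_const s).subtype_mk
  refine ⟨hm, Measure.AbsolutelyContinuous.mk fun A hA h0 => ?_⟩
  have hio : MeasurableSet {t : ℝ | 0 < t} := measurableSet_Ioi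
  rw [Measure.map_apply hm hA]
  have key : ∀ B : Set SemiAxis, lebesgue B = volume (Subtype.val '' B) :=
    fun B => comap_subtype_coe_apply hio volume B
  rw [key] at h0 ⊢
  have hsub : (Subtype.val '' (scale s hs ⁻¹' A)) ⊆
      (fun t : ℝ => s⁻¹ * t) ⁻¹' (Subtype.val '' A) := by
    rintro _ ⟨t, ht, rfl⟩
    exact ⟨scale s hs t, ht, by simp only [scale]; ring⟩
  refine measure_mono_null hsub ?_
  rw [Real.volume_preimage_mul_left (inv_ne_zero hs.ne'), h0, mul_zero]

/-- The dilation operator `(σ_s x)(t) = x(t / s)` on `L_∞(0, ∞)`. -/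
def dilation (s : ℝ) (hs : 0 < s) : LInfty →ₗ[ℝ] LInfty where
  toFun x := ⟨fun t => x.1 (scale s hs t),
    And.intro (x.2.1.comp_quasiMeasurePreserving (quasiMeasurePreserving_scale s hs))
      (x.2.2.imp fun _ h _ => h _)⟩
  map_add' _ _ := rfl
  map_smul' _ _ := rfl

/-- A generalised limit: a positive normalised linear functional on `L_∞(0, ∞)` that vanishes on
every function tending to `0` at infinity. -/
structure IsGeneralisedLimit (γ : LInfty →ₗ[ℝ] ℝ) : Prop where
  nonneg : ∀ z : LInfty, (∀ t, 0 ≤ z.1 t) → 0 ≤ γ z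
  normalised : ∀ z : LInfty, (∀ t, z.1 t = 1) → γ z = 1
  vanish : ∀ z : LInfty, Tendsto z.1 atTop (𝓝 0) → γ z = 0

/-- Dilation invariance of a linear functional on `L_∞(0, ∞)`. -/
def IsDilationInvariant (γ : LInfty →ₗ[ℝ] ℝ) : Prop :=
  ∀ (s : ℝ) (hs : 0 < s) (z : LInfty), γ (dilation s hs z) = γ z

/-- The functional takes equal values on almost everywhere equal functions, i.e. it is a functional
on almost everywhere equivalence classes. -/
def RespectsAE (γ : LInfty →ₗ[ℝ] ℝ) : Prop :=
  ∀ z w : LInfty, z.1 =ᵐ[lebesgue] w.1 → γ z = γ w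

/-- The (logarithmic) Cesàro operator `(Mx)(t) = (1 / log t) ∫_1^t x(s) ds/s` for `t > 0`. -/
def cesaro (x : ℝ → ℝ) (t : SemiAxis) : ℝ :=
  (1 / Real.log t.1) * ∫ s in (1 : ℝ)..t.1, x s / s

open Classical in
/-- The value of a functional on a function on `(0, ∞)`, when this function is in `L_∞(0, ∞)`
(and `0` otherwise). -/
def evalAt (γ : LInfty →ₗ[ℝ] ℝ) (x : SemiAxis → ℝ) : ℝ :=
  if hx : x ∈ LInfty then γ ⟨x, hx⟩ else 0

/-! ### Traces on von Neumann algebras and the Dixmier ideal -/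

universe u

variable {H : Type u} [NormedAddCommGroup H] [InnerProductSpace ℂ H] [CompleteSpace H]

/-- `τ` is a faithful normal semi-finite trace on the von Neumann algebra `N`. Only the values of
`τ` on the positive elements of `N` matter. -/
structure IsFaithfulNormalSemifiniteTrace (N : VonNeumannAlgebra H)
    (τ : (H →L[ℂ] H) → ℝ≥0∞) : Prop where
  map_add : ∀ a ∈ N, ∀ b ∈ N, 0 ≤ a → 0 ≤ b → τ (a + b) = τ a + τ b
  map_smul : ∀ c : ℝ≥0, ∀ a ∈ N, 0 ≤ a → τ ((c : ℝ) • a) = c * τ a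
  tracial : ∀ a ∈ N, τ (star a * a) = τ (a * star a)
  faithful : ∀ a ∈ N, 0 ≤ a → τ a = 0 → a = 0
  normal : ∀ S : Set (H →L[ℂ] H), S.Nonempty → (∀ a ∈ S, a ∈ N ∧ 0 ≤ a) →
    DirectedOn (· ≤ ·) S → ∀ b ∈ N, IsLUB S b → τ b = ⨆ a ∈ S, τ a
  semifinite : ∀ a ∈ N, 0 ≤ a → a ≠ 0 → ∃ b ∈ N, 0 ≤ b ∧ b ≤ a ∧ b ≠ 0 ∧ τ b < ∞

/-- The generalised singular value function
`μ(t, A) = inf {‖A p‖ : p a projection in N with τ(1 - p) ≤ t}`. -/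
def singularValue (N : VonNeumannAlgebra H) (τ : (H →L[ℂ] H) → ℝ≥0∞) (A : H →L[ℂ] H)
    (t : ℝ) : ℝ :=
  sInf {r : ℝ | ∃ p ∈ N, IsStarProjection p ∧ τ (1 - p) ≤ ENNReal.ofReal t ∧ r = ‖A * p‖}

/-- The Marcinkiewicz operator space (Dixmier ideal) `𝓜_{1,∞}(N, τ)`: all `A ∈ N` with
`sup_{t > 0} (1 / log (1 + t)) ∫_0^t μ(s, A) ds < ∞`. -/
def dixmierIdeal (N : VonNeumannAlgebra H) (τ : (H →L[ℂ] H) → ℝ≥0∞) : Set (H →L[ℂ] H) :=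
  {A | A ∈ N ∧ ∃ C : ℝ, ∀ t : ℝ, 0 < t →
    (1 / Real.log (1 + t)) * ∫ s in (0 : ℝ)..t, singularValue N τ A s ≤ C}

/-! ### The functionals `ξ_γ` -/

/-- The function `x ↦ exp (-x ^ (-q))` on `[0, ∞)`, equal to its limit `0` at `x = 0`
(and extended by `0` to the negative reals, which do not matter). -/
def expNegPow (q x : ℝ) : ℝ := if 0 < x then Real.exp (-(x ^ (-q))) else 0

/-- The operator `exp (-(tA) ^ (-q))`, through the continuous functional calculus of `tA`. -/
def heatOp (q : ℝ) (A : H →L[ℂ] H) (t : ℝ) : H →L[ℂ] H := cfc (expNegPow q) (t • A)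

/-- The heat kernel function `t ↦ (1 / t) τ(exp (-(tA) ^ (-q)))`. -/
def heatFun (τ : (H →L[ℂ] H) → ℝ≥0∞) (q : ℝ) (A : H →L[ℂ] H) (t : ℝ) : ℝ :=
  (1 / t) * (τ (heatOp q A t)).toReal

/-- `ξ_γ(A) = (γ ∘ M)(t ↦ (1 / t) τ(exp (-(tA) ^ (-q))))` for positive `A`. -/
def xiPos (τ : (H →L[ℂ] H) → ℝ≥0∞) (q : ℝ) (γ : LInfty →ₗ[ℝ] ℝ) (A : H →L[ℂ] H) : ℝ :=
  evalAt γ (cesaro (heatFun τ q A))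

/-- `ξ_γ(A)` for arbitrary `A`, through the positive and negative parts of the real and the
imaginary part of `A`. -/
def xi (τ : (H →L[ℂ] H) → ℝ≥0∞) (q : ℝ) (γ : LInfty →ₗ[ℝ] ℝ) (A : H →L[ℂ] H) : ℂ :=
  ((xiPos τ q γ (ℜ A : H →L[ℂ] H)⁺ - xiPos τ q γ (ℜ A : H →L[ℂ] H)⁻ : ℝ) : ℂ) +
    Complex.I * ((xiPos τ q γ (ℑ A : H →L[ℂ] H)⁺ - xiPos τ q γ (ℑ A : H →L[ℂ] H)⁻ : ℝ) : ℂ)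

/-- `φ` restricts to a complex linear functional on the set `S` (in the application, a linear
subspace) of operators. -/
structure IsLinearFunctionalOn (S : Set (H →L[ℂ] H)) (φ : (H →L[ℂ] H) → ℂ) : Prop where
  map_add : ∀ A ∈ S, ∀ B ∈ S, φ (A + B) = φ A + φ B
  map_smul : ∀ (c : ℂ), ∀ A ∈ S, φ (c • A) = c * φ A

end HeatKernel

end

noncomputable section

namespace HeatKernel

universe u

variable {H : Type u} [NormedAddCommGroup H] [InnerProductSpace ℂ H] [CompleteSpace H]

/-! ### Von Neumann algebras and the functional calculus -/

/-! Write h_B(t) = (1/t) τ(exp(-(tB)^(-q))). For c > 0 one has h_{cB}(t) = c h_B(ct), and a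
logarithmic mean turns this into (M h_{cB})(t) = c (M h_B)(ct) + o(1) (`heatFun_smul`,
`apply_cesaro_comp_mul`). Homogeneity of ξ_γ under positive scalars therefore says that γ is
constant on the dilation orbit of x_A = M h_{(ℜ A)⁺} - M h_{(ℜ A)⁻} (`apply_dilation_sub`).
Dilations commute, so a Markov–Kakutani averaging of γ over them yields a dilation invariant
generalised limit with the same value at each x_A (`exists_dilationInvariant`). Imaginary parts
follow on replacing A by -iA.

Almost everywhere equality is respected after composing with z ↦ ∫_0^1 z(t e^{-v}) dv. This leaves a
dilation invariant generalised limit unchanged at the logarithmic means in question, which vary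
slowly because x(t) log t is increasing for t ≥ 1 (`apply_smooth_cesaro`).

The analytic work is to show that M h_B is bounded for B = (ℜ A)⁺, in terms of μ(·, A) itself, so
that B need not be shown to lie in the ideal. Continuous cut-offs replace spectral projections and
give a comparison of distribution functions (`trace_ramp_posPart_realPart_le`,
`trace_ramp_le_volume`). A dyadic layer-cake argument and normality turn it into τ(F(B)) ≤ 20 ∫ F(24
μ(s, A)) ds for increasing continuous F ≥ 0 with F(0) = 0 (`trace_cfc_le_lintegral`). Tonelli and
the logarithmic growth of ∫_0^t μ then bound the means (`exists_lintegral_trace_heatOp_le`). -/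

theorem cfc_mem_vonNeumann (N : VonNeumannAlgebra H) {A : H →L[ℂ] H} (hA : A ∈ N) (f : ℝ → ℝ) :
    cfc f A ∈ N := by
  -- By the double commutant it suffices that whatever commutes with A commutes with `cfc f A`,
  -- which requires nothing of f.
  rw [← VonNeumannAlgebra.commutant_commutant N, VonNeumannAlgebra.mem_commutant_iff]
  intro g hg
  have h : Commute A g := (VonNeumannAlgebra.mem_commutant_iff.1 hg) A hA
  exact (h.cfc_real f).symm.eq

theorem real_smul_mem_vonNeumann (N : VonNeumannAlgebra H) {A : H →L[ℂ] H} (hA : A ∈ N) (c : ℝ) :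
    c • A ∈ N := by
  have h : ((c : ℂ) • A) ∈ N.toStarSubalgebra := N.toStarSubalgebra.smul_mem hA (c : ℂ)
  have e : c • A = (c : ℂ) • A := (Complex.coe_smul c A).symm
  rw [e]; exact h

theorem complex_smul_mem_vonNeumann (N : VonNeumannAlgebra H) {A : H →L[ℂ] H} (hA : A ∈ N) (c : ℂ) :
    c • A ∈ N :=
  N.toStarSubalgebra.smul_mem hA c

theorem cfc_mul_cfc {f g : ℝ → ℝ} (hf : Continuous f) (hg : Continuous g) (T : H →L[ℂ] H) :
    cfc f T * cfc g T = cfc (fun x => f x * g x) T :=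
  (cfc_mul f g T hf.continuousOn hg.continuousOn).symm

theorem cfc_mul_self_mul_cfc {f : ℝ → ℝ} (hf : Continuous f) {T : H →L[ℂ] H}
    (hT : IsSelfAdjoint T) : cfc f T * T * cfc f T = cfc (fun x => f x * f x * x) T := by
  have h : cfc f T * cfc (fun x : ℝ => x) T * cfc f T = cfc (fun x => f x * f x * x) T := by
    rw [cfc_mul_cfc hf continuous_id', cfc_mul_cfc (hf.fun_mul continuous_id') hf]
    congr 1; ext x; ring
  rwa [cfc_id' ℝ T] at h

/-! ### Elementary properties of the trace. -/

namespace IsFaithfulNormalSemifiniteTrace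

variable {N : VonNeumannAlgebra H} {τ : (H →L[ℂ] H) → ℝ≥0∞}

theorem map_zero (hτ : IsFaithfulNormalSemifiniteTrace N τ) : τ 0 = 0 := by
  have := hτ.map_smul 0 0 (zero_mem N) le_rfl
  simpa using this

theorem mono (hτ : IsFaithfulNormalSemifiniteTrace N τ) {a b : H →L[ℂ] H} (ha : a ∈ N)
    (hb : b ∈ N) (h0 : 0 ≤ a) (hab : a ≤ b) : τ a ≤ τ b := by
  have := hτ.map_add a ha (b - a) (sub_mem hb ha) h0 (sub_nonneg.2 hab)
  rw [add_sub_cancel] at this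
  rw [this]
  exact le_self_add

theorem map_sum (hτ : IsFaithfulNormalSemifiniteTrace N τ) {ι : Type*} (s : Finset ι)
    (a : ι → H →L[ℂ] H) (ha : ∀ i, a i ∈ N) (h0 : ∀ i, 0 ≤ a i) :
    τ (∑ i ∈ s, a i) = ∑ i ∈ s, τ (a i) := by
  classical
  induction s using Finset.induction_on with
  | empty => simpa using hτ.map_zero
  | insert i s hi ih =>
    rw [Finset.sum_insert hi, Finset.sum_insert hi,
      hτ.map_add _ (ha i) _ (sum_mem fun j _ => ha j) (h0 i) (Finset.sum_nonneg fun j _ => h0 j), ih]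

/-- Compressing by a contraction does not increase the trace. -/
theorem conj_le (hτ : IsFaithfulNormalSemifiniteTrace N τ) {w x : H →L[ℂ] H} (hw : w ∈ N)
    (hx : x ∈ N) (h0 : 0 ≤ w) (h1 : ‖x‖ ≤ 1) : τ (star x * w * x) ≤ τ w := by
  set v := cfc Real.sqrt w with hv
  have hvN : v ∈ N := cfc_mem_vonNeumann N hw _
  have hvs : star v = v := IsSelfAdjoint.cfc.star_eq
  have hvv : v * v = w := by
    rw [hv, ← cfc_mul _ _ w Real.continuous_sqrt.continuousOn Real.continuous_sqrt.continuousOn]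
    conv_rhs => rw [← cfc_id ℝ w]
    refine cfc_congr fun y hy => ?_
    exact Real.mul_self_sqrt (spectrum_nonneg_of_nonneg h0 hy)
  -- Traciality exchanges the two factors: the trace becomes that of v x x* v, which is at most v v
  -- = w since x x* ≤ 1.
  have e1 : star x * w * x = star (v * x) * (v * x) := by
    rw [star_mul, hvs, ← hvv]; simp only [mul_assoc]
  rw [e1, hτ.tracial _ (mul_mem hvN hx)]
  refine hτ.mono (mul_mem (mul_mem hvN hx) (star_mem (mul_mem hvN hx))) hw (mul_star_self_nonneg _) ?_
  have h2 : x * star x ≤ 1 := by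
    have h3 := CStarAlgebra.mul_star_le_algebraMap_norm_sq (a := x)
    refine h3.trans ?_
    have : algebraMap ℝ (H →L[ℂ] H) (‖x‖ ^ 2) ≤ algebraMap ℝ (H →L[ℂ] H) 1 :=
      algebraMap_mono _ (by nlinarith [norm_nonneg x])
    simpa using this
  calc v * x * star (v * x) = v * (x * star x) * star v := by
        rw [star_mul]; simp only [mul_assoc]
    _ ≤ v * 1 * star v := star_right_conjugate_le_conjugate h2 v
    _ = w := by rw [mul_one, hvs, hvv]

end IsFaithfulNormalSemifiniteTrace

/-! ### Ramp functions -/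

/-- The continuous function equal to `0` for `x ≤ a`, to `1` for `2 * a ≤ x` and affine between. -/
def ramp (a x : ℝ) : ℝ := max 0 (min 1 ((x - a) / a))

theorem continuous_ramp (a : ℝ) : Continuous (ramp a) := by
  unfold ramp; fun_prop

theorem ramp_nonneg (a x : ℝ) : 0 ≤ ramp a x := le_max_left _ _

theorem ramp_le_one (a x : ℝ) : ramp a x ≤ 1 := max_le zero_le_one (min_le_left _ _)

theorem ramp_eq_zero {a x : ℝ} (ha : 0 < a) (h : x ≤ a) : ramp a x = 0 :=
  max_eq_left ((min_le_right _ _).trans (div_nonpos_of_nonpos_of_nonneg (by linarith) ha.le))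

theorem ramp_eq_one {a x : ℝ} (ha : 0 < a) (h : 2 * a ≤ x) : ramp a x = 1 := by
  unfold ramp
  rw [min_eq_left, max_eq_right zero_le_one]
  rw [le_div_iff₀ ha]; linarith

theorem norm_le_of_star_mul_self_le {x : H →L[ℂ] H} {r : ℝ} (hr : 0 ≤ r)
    (h : ‖star x * x‖ ≤ r ^ 2) : ‖x‖ ≤ r := by
  rw [CStarRing.norm_star_mul_self] at h
  nlinarith [norm_nonneg x]

theorem norm_mul_star_self_le_one {x : H →L[ℂ] H} (h : ‖x * star x‖ ≤ 1) : ‖star x‖ ≤ 1 := by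
  refine norm_le_of_star_mul_self_le zero_le_one ?_
  simpa using h

/-! ### Distribution estimates by continuous cut-offs. -/

section Distribution

variable {N : VonNeumannAlgebra H} {τ : (H →L[ℂ] H) → ℝ≥0∞}

/-- A soft Chebyshev inequality. The cut-off G of X X* factors as D D* with D = K X. Since X m is
small, D m² D* is at most G/2, so G ≤ 2 D (1 - m²) D*, and D is a contraction. Here m is only a
positive contraction, not a projection, so that the output of `exists_soft_complement` can be fed
in. -/
theorem trace_ramp_mul_star_le (hτ : IsFaithfulNormalSemifiniteTrace N τ) {X m : H →L[ℂ] H}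
    (hX : X ∈ N) (hm : m ∈ N) (hm0 : 0 ≤ m) (hm1 : m ≤ 1) {r : ℝ} (hr : 0 < r)
    (hXm : ‖X * m‖ ≤ r) : τ (cfc (ramp (2 * r ^ 2)) (X * star X)) ≤ 4 * τ (1 - m) := by
  set a := 2 * r ^ 2 with ha
  have ha0 : 0 < a := by positivity
  set T := X * star X with hT
  have hT0 : 0 ≤ T := mul_star_self_nonneg X
  have hTN : T ∈ N := mul_mem hX (star_mem hX)
  -- Chosen so that k(x)² x = `ramp a x`. The maximum avoids division by zero and is harmless
  -- because the ramp vanishes for x ≤ a.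
  let k : ℝ → ℝ := fun x => Real.sqrt (ramp a x) / Real.sqrt (max x a)
  have hkpos : ∀ x, 0 < Real.sqrt (max x a) := fun x => Real.sqrt_pos.2 (lt_max_of_lt_right ha0)
  have hkc : Continuous k := by
    refine Continuous.div ?_ ?_ fun x => (hkpos x).ne'
    · exact Real.continuous_sqrt.comp (continuous_ramp a)
    · fun_prop
  have hkk : ∀ x, k x * k x = ramp a x / max x a := by
    intro x
    simp only [k]
    rw [div_mul_div_comm, Real.mul_self_sqrt (ramp_nonneg _ _),
      Real.mul_self_sqrt (le_max_of_le_right ha0.le)]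
  set G := cfc (ramp a) T with hG
  have hG0 : 0 ≤ G := cfc_nonneg fun x _ => ramp_nonneg a x
  have hGN : G ∈ N := cfc_mem_vonNeumann N hTN _
  set K := cfc k T with hK
  have hKN : K ∈ N := cfc_mem_vonNeumann N hTN _
  have hKs : star K = K := IsSelfAdjoint.cfc.star_eq
  set D := K * X with hD
  have hDN : D ∈ N := mul_mem hKN hX
  have hDD : D * star D = G := by
    have : D * star D = K * T * K := by
      rw [hD, star_mul, hKs, hT]; simp only [mul_assoc]
    rw [this, hG, hK, cfc_mul_self_mul_cfc hkc (IsSelfAdjoint.of_nonneg hT0)]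
    refine cfc_congr fun x hx => ?_
    simp only [hkk]
    rcases le_total x a with h | h
    · simp [ramp_eq_zero ha0 h]
    · rw [max_eq_left h, div_mul_cancel₀ _ (by linarith)]
  have hms : star m = m := (IsSelfAdjoint.of_nonneg hm0).star_eq
  -- Uses k² ≤ `ramp a` / a together with 2 r² = a.
  have hDm : D * (m * m) * star D + D * (m * m) * star D ≤ G := by
    have h1 : (X * m) * star (X * m) ≤ algebraMap ℝ (H →L[ℂ] H) (r ^ 2) :=
      CStarAlgebra.mul_star_le_algebraMap_norm_sq.trans
        (algebraMap_mono _ (by nlinarith [norm_nonneg (X * m)]))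
    have h2 : D * (m * m) * star D = K * ((X * m) * star (X * m)) * star K := by
      rw [hD, star_mul, star_mul, hms]; simp only [mul_assoc]
    have h3 : D * (m * m) * star D ≤ cfc (fun x => r ^ 2 * (k x * k x)) T := by
      rw [h2]
      refine (star_right_conjugate_le_conjugate h1 K).trans_eq ?_
      rw [cfc_const_mul (r ^ 2) (fun x => k x * k x) T (hkc.fun_mul hkc).continuousOn,
        ← cfc_mul_cfc hkc hkc, hKs, Algebra.algebraMap_eq_smul_one]
      simp [← hK]
    refine (add_le_add h3 h3).trans ?_
    have hc : Continuous fun x => r ^ 2 * (k x * k x) := continuous_const.mul (hkc.fun_mul hkc)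
    rw [← cfc_add T _ _ hc.continuousOn hc.continuousOn]
    refine cfc_mono (fun x hx => ?_) (hc.add hc).continuousOn (continuous_ramp a).continuousOn
    simp only [hkk]
    have h4 : a ≤ max x a := le_max_right _ _
    have h5 : 0 < max x a := ha0.trans_le h4
    have h6 : ramp a x / max x a ≤ ramp a x / a :=
      div_le_div_of_nonneg_left (ramp_nonneg _ _) ha0 h4
    calc r ^ 2 * (ramp a x / max x a) + r ^ 2 * (ramp a x / max x a)
        = a * (ramp a x / max x a) := by rw [ha]; ring
      _ ≤ a * (ramp a x / a) := by gcongr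
      _ = ramp a x := by field_simp
  set w := 1 - m * m with hw
  have hwN : w ∈ N := sub_mem (one_mem N) (mul_mem hm hm)
  have hm2 : ‖m‖ ≤ 1 := (CStarAlgebra.norm_le_one_iff_of_nonneg m hm0).2 hm1
  have hw0 : 0 ≤ w := by
    rw [hw, sub_nonneg]
    have h3 := CStarAlgebra.mul_star_le_algebraMap_norm_sq (a := m)
    rw [hms] at h3
    refine h3.trans ?_
    have : algebraMap ℝ (H →L[ℂ] H) (‖m‖ ^ 2) ≤ algebraMap ℝ (H →L[ℂ] H) 1 :=
      algebraMap_mono _ (by nlinarith [norm_nonneg m])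
    simpa using this
  -- This is (1 - m)² ≥ 0 rearranged.
  have hw1 : w ≤ (1 - m) + (1 - m) := by
    have h : 0 ≤ star (1 - m) * (1 - m) := star_mul_self_nonneg _
    rw [star_sub, star_one, hms] at h
    rw [← sub_nonneg]
    convert h using 1
    rw [hw]; noncomm_ring
  have hGle : G ≤ D * w * star D + D * w * star D := by
    rw [← sub_nonneg] at hDm ⊢
    refine hDm.trans_eq ?_
    have : D * w * star D = G - D * (m * m) * star D := by
      rw [← hDD, hw]; noncomm_ring
    rw [this]; abel
  have hDw0 : 0 ≤ D * w * star D := by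
    have := star_right_conjugate_le_conjugate hw0 D
    simpa using this
  have hDwN : D * w * star D ∈ N := mul_mem (mul_mem hDN hwN) (star_mem hDN)
  have hDnorm : ‖star D‖ ≤ 1 := by
    refine norm_mul_star_self_le_one ?_
    rw [hDD, CStarAlgebra.norm_le_one_iff_of_nonneg G hG0]
    refine (cfc_le_algebraMap _ 1 T (fun x _ => ramp_le_one a x)
      (continuous_ramp a).continuousOn).trans_eq ?_
    simp
  have hDw : τ (D * w * star D) ≤ τ w := by
    have := hτ.conj_le hwN (star_mem hDN) hw0 hDnorm
    rwa [star_star] at this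
  have hp0 : 0 ≤ 1 - m := sub_nonneg.2 hm1
  have hpN : 1 - m ∈ N := sub_mem (one_mem N) hm
  have hwle : τ w ≤ 2 * τ (1 - m) := by
    refine (hτ.mono hwN (add_mem hpN hpN) hw0 hw1).trans_eq ?_
    rw [hτ.map_add _ hpN _ hpN hp0 hp0, two_mul]
  calc τ G ≤ τ (D * w * star D) + τ (D * w * star D) := by
        rw [← hτ.map_add _ hDwN _ hDwN hDw0 hDw0]
        exact hτ.mono hGN (add_mem hDwN hDwN) hG0 hGle
    _ ≤ 2 * τ (1 - m) + 2 * τ (1 - m) := add_le_add (hDw.trans hwle) (hDw.trans hwle)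
    _ = 4 * τ (1 - m) := by rw [← add_mul]; norm_num

end Distribution

section Distribution

variable {N : VonNeumannAlgebra H} {τ : (H →L[ℂ] H) → ℝ≥0∞}

/-- For positive `a = s * s` and `b = t * t`, a positive contraction `m` which is almost
orthogonal to both and whose complement has small trace. -/
theorem exists_soft_complement (hτ : IsFaithfulNormalSemifiniteTrace N τ)
    {s s' t t' : H →L[ℂ] H} (hs : s ∈ N) (hs' : s' ∈ N) (ht : t ∈ N) (ht' : t' ∈ N)
    (hss : star s = s) (hts : star t = t) (hs0 : 0 ≤ s') (ht0 : 0 ≤ t')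
    (hse : s * s' * s = s * s) (hte : t * t' * t = t * t) {ε : ℝ} (hε : 0 < ε) :
    ∃ m ∈ N, 0 ≤ m ∧ m ≤ 1 ∧ ‖s * m‖ ≤ ε ∧ ‖t * m‖ ≤ ε ∧ τ (1 - m) ≤ τ s' + τ t' := by
  set y := s * s + t * t with hy
  have hss0 : 0 ≤ s * s := by simpa [hss] using star_mul_self_nonneg s
  have htt0 : 0 ≤ t * t := by simpa [hts] using star_mul_self_nonneg t
  have hy0 : 0 ≤ y := add_nonneg hss0 htt0
  have hysa : IsSelfAdjoint y := IsSelfAdjoint.of_nonneg hy0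
  have hyN : y ∈ N := add_mem (mul_mem hs hs) (mul_mem ht ht)
  -- With m = δ/(δ + y) and C = (δ + y)^(-1/2) one gets m y m ≤ δ, which controls s m and t m, and 1
  -- - m = C y C, which splits into one term for s and one for t. This m plays the role of an
  -- intersection of projections.
  set δ := ε ^ 2
  have hδ0 : 0 < δ := by positivity
  have hpos : ∀ x : ℝ, 0 < δ + max x 0 := fun x => add_pos_of_pos_of_nonneg hδ0 (le_max_right _ _)
  let c : ℝ → ℝ := fun x => 1 / Real.sqrt (δ + max x 0)
  let g : ℝ → ℝ := fun x => δ / (δ + max x 0)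
  have hc : Continuous c := by
    refine continuous_const.div (by fun_prop) fun x => (Real.sqrt_pos.2 (hpos x)).ne'
  have hg : Continuous g := continuous_const.div (by fun_prop) fun x => (hpos x).ne'
  have hcc : ∀ x, c x * c x = 1 / (δ + max x 0) := fun x => by
    simp only [c]
    rw [div_mul_div_comm, Real.mul_self_sqrt (hpos x).le, one_mul]
  have hg0 : ∀ x, 0 ≤ g x := fun x => div_nonneg hδ0.le (hpos x).le
  have hg1 : ∀ x, g x ≤ 1 := fun x => by
    simp only [g]
    rw [div_le_one (hpos x)]
    linarith [le_max_right x 0]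
  set C := cfc c y with hC
  set m := cfc g y with hm
  have hCN : C ∈ N := cfc_mem_vonNeumann N hyN _
  have hmN : m ∈ N := cfc_mem_vonNeumann N hyN _
  have hCs : star C = C := IsSelfAdjoint.cfc.star_eq
  have hms : star m = m := IsSelfAdjoint.cfc.star_eq
  have hm0 : 0 ≤ m := cfc_nonneg fun x _ => hg0 x
  have hm1 : m ≤ 1 := cfc_le_one g y fun x _ => hg1 x
  have hCyC : C * y * C = 1 - m := by
    rw [hC, cfc_mul_self_mul_cfc hc hysa, hm, ← cfc_const_one ℝ y,
      ← cfc_sub (fun _ => 1) g y continuousOn_const hg.continuousOn]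
    refine cfc_congr fun x hx => ?_
    have hx0 : 0 ≤ x := spectrum_nonneg_of_nonneg hy0 hx
    have := hpos x
    simp only [hcc, g]
    rw [max_eq_left hx0] at this ⊢
    field_simp
    ring
  have hmym : m * y * m ≤ algebraMap ℝ (H →L[ℂ] H) δ := by
    rw [hm, cfc_mul_self_mul_cfc hg hysa]
    refine cfc_le_algebraMap _ δ y (fun x hx => ?_) ((hg.fun_mul hg).fun_mul continuous_id').continuousOn
    have hx0 : 0 ≤ x := spectrum_nonneg_of_nonneg hy0 hx
    have h := hpos x
    have e : g x * x ≤ δ := by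
      simp only [g]
      rw [max_eq_left hx0] at h ⊢
      rw [div_mul_eq_mul_div, div_le_iff₀ h]
      nlinarith
    calc g x * g x * x = g x * (g x * x) := by ring
      _ ≤ 1 * δ := mul_le_mul (hg1 x) e (mul_nonneg (hg0 x) hx0) zero_le_one
      _ = δ := one_mul δ
  have hCyC1 : C * y * C ≤ 1 := by rw [hCyC]; simpa using hm0
  -- The relation r r' r = r² gives C r² C = (r C)* r' (r C), and r C is a contraction because r² ≤
  -- y and C y C ≤ 1.
  have main : ∀ r r' : H →L[ℂ] H, r ∈ N → r' ∈ N → star r = r → 0 ≤ r' → r * r' * r = r * r →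
      r * r ≤ y → ‖r * m‖ ≤ ε ∧ τ (C * (r * r) * C) ≤ τ r' := by
    intro r r' hr hr' hrs hr0 hre hry
    constructor
    · refine norm_le_of_star_mul_self_le hε.le ?_
      rw [CStarAlgebra.norm_le_iff_le_algebraMap _ (by positivity) (star_mul_self_nonneg _)]
      refine le_trans ?_ hmym
      have := star_right_conjugate_le_conjugate hry m
      rw [hms] at this
      refine le_trans (le_of_eq ?_) this
      rw [star_mul, hms, hrs]; simp only [mul_assoc]
    · have h1 : ‖r * C‖ ≤ 1 := by
        refine norm_le_of_star_mul_self_le zero_le_one ?_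
        rw [one_pow, CStarAlgebra.norm_le_one_iff_of_nonneg _ (star_mul_self_nonneg _)]
        refine le_trans ?_ hCyC1
        have := star_right_conjugate_le_conjugate hry C
        rw [hCs] at this
        refine le_trans (le_of_eq ?_) this
        rw [star_mul, hCs, hrs]; simp only [mul_assoc]
      have h2 := hτ.conj_le hr' (mul_mem hr hCN) hr0 h1
      convert h2 using 2
      rw [star_mul, hCs, hrs, ← hre]; simp only [mul_assoc]
  obtain ⟨h1, h2⟩ := main s s' hs hs' hss hs0 hse (le_add_of_nonneg_right htt0)
  obtain ⟨h3, h4⟩ := main t t' ht ht' hts ht0 hte (le_add_of_nonneg_left hss0)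
  refine ⟨m, hmN, hm0, hm1, h1, h3, ?_⟩
  have e : 1 - m = C * (s * s) * C + C * (t * t) * C := by
    rw [← hCyC, hy]; noncomm_ring
  have hpos' : ∀ r : H →L[ℂ] H, 0 ≤ r → 0 ≤ C * r * C := fun r hr => by
    simpa [hCs] using star_right_conjugate_le_conjugate hr C
  rw [e, hτ.map_add _ (mul_mem (mul_mem hCN (mul_mem hs hs)) hCN) _
    (mul_mem (mul_mem hCN (mul_mem ht ht)) hCN) (hpos' _ hss0) (hpos' _ htt0)]
  exact add_le_add h2 h4

theorem posPart_eq_cfc (R : H →L[ℂ] H) : R⁺ = cfc (fun x : ℝ => x⁺) R := by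
  have hpc : Continuous fun x : ℝ => x⁺ := continuous_id'.max continuous_const
  rw [CFC.posPart_def, cfcₙ_eq_cfc hpc.continuousOn]

/-- The left side vanishes for x ≤ 6r, and for x ≥ 6r one has x² ≥ 36 r² = 2 · 2(3r)², where the
right ramp has reached 1. -/
theorem cfc_ramp_posPart_le {R : H →L[ℂ] H} (hRsa : IsSelfAdjoint R) {r : ℝ} (hr : 0 < r) :
    cfc (ramp (6 * r)) R⁺ ≤ cfc (ramp (2 * (3 * r) ^ 2)) (R * star R) := by
  have hpc : Continuous fun x : ℝ => x⁺ := continuous_id'.max continuous_const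
  have e1 := posPart_eq_cfc R
  have e2 : R * star R = cfc (fun x : ℝ => x * x) R := by
    rw [hRsa.star_eq, ← cfc_mul_cfc continuous_id' continuous_id', cfc_id' ℝ R]
  rw [e1, e2, ← cfc_comp' (ramp (6 * r)) _ R (continuous_ramp _).continuousOn hpc.continuousOn,
    ← cfc_comp' (ramp (2 * (3 * r) ^ 2)) _ R (continuous_ramp _).continuousOn (by fun_prop)]
  refine cfc_mono (fun x _ => ?_) ((continuous_ramp _).comp hpc).continuousOn
    ((continuous_ramp _).comp (by fun_prop)).continuousOn
  rcases le_total x⁺ (6 * r) with h | h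
  · rw [ramp_eq_zero (by positivity) h]; exact ramp_nonneg _ _
  · have hx : 6 * r ≤ x := by
      rcases le_max_iff.1 (h.trans_eq (rfl : x⁺ = max x 0)) with h' | h'
      · exact h'
      · linarith
    have e3 : ramp (2 * (3 * r) ^ 2) (x * x) = 1 := ramp_eq_one (by positivity) (by nlinarith)
    rw [e3]
    exact ramp_le_one _ _

/-- Distributional estimate for the positive part of the real part of `A`. -/
theorem trace_ramp_posPart_realPart_le (hτ : IsFaithfulNormalSemifiniteTrace N τ)
    {A p : H →L[ℂ] H} (hA : A ∈ N) (hp : p ∈ N) (hpp : IsStarProjection p) {r : ℝ} (hr : 0 < r)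
    (hAp : ‖A * p‖ ≤ r) :
    τ (cfc (ramp (6 * r)) (ℜ A : H →L[ℂ] H)⁺) ≤ 20 * τ (1 - p) := by
  have hps : star p = p := hpp.isSelfAdjoint.star_eq
  have hpi : p * p = p := hpp.isIdempotentElem.eq
  have hp0 : 0 ≤ p := hpp.nonneg
  have hp1 : p ≤ 1 := hpp.le_one
  set T := A * star A with hT
  have hT0 : 0 ≤ T := mul_star_self_nonneg A
  have hTsa : IsSelfAdjoint T := IsSelfAdjoint.of_nonneg hT0
  have hTN : T ∈ N := mul_mem hA (star_mem hA)
  set a := 2 * r ^ 2 with ha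
  have ha0 : 0 < a := by positivity
  set t' := cfc (ramp a) T with ht'
  have h1 : τ t' ≤ 4 * τ (1 - p) := trace_ramp_mul_star_le hτ hA hp hp0 hp1 hr hAp
  have ht'0 : 0 ≤ t' := cfc_nonneg fun x _ => ramp_nonneg a x
  -- The threshold of t² is twice that of t', so t' acts as 1 wherever t is nonzero; hence t t' t =
  -- t².
  let k : ℝ → ℝ := fun x => Real.sqrt (ramp (2 * a) x)
  have hk : Continuous k := Real.continuous_sqrt.comp (continuous_ramp _)
  have hkk : ∀ x, k x * k x = ramp (2 * a) x := fun x => Real.mul_self_sqrt (ramp_nonneg _ _)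
  have hk1 : ∀ x, k x ≤ 1 := fun x => by
    simp only [k]
    exact Real.sqrt_le_one.2 (ramp_le_one _ _)
  have hk0 : ∀ x, 0 ≤ k x := fun x => Real.sqrt_nonneg _
  set t := cfc k T with ht
  have hts : star t = t := IsSelfAdjoint.cfc.star_eq
  have ht0 : 0 ≤ t := cfc_nonneg fun x _ => hk0 x
  have htnorm : ‖t‖ ≤ 1 :=
    (CStarAlgebra.norm_le_one_iff_of_nonneg t ht0).2 (cfc_le_one k T fun x _ => hk1 x)
  have hte : t * t' * t = t * t := by
    rw [ht, ht', cfc_mul_cfc hk (continuous_ramp a),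
      cfc_mul_cfc (hk.fun_mul (continuous_ramp a)) hk, cfc_mul_cfc hk hk]
    congr 1
    ext x
    have e : k x * ramp a x * k x = k x * k x * ramp a x := by ring
    rw [e, hkk]
    rcases le_total x (2 * a) with h | h
    · rw [ramp_eq_zero (by positivity) h, zero_mul]
    · rw [ramp_eq_one ha0 h, mul_one]
  set q := 1 - p with hq
  have hqi : q * q = q := by rw [hq]; simp [mul_sub, sub_mul, hpi]
  have hqs : star q = q := by rw [hq]; simp [hps]
  have hq0 : 0 ≤ q := sub_nonneg.2 hp1
  have hqN : q ∈ N := sub_mem (one_mem N) hp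
  have htN : t ∈ N := cfc_mem_vonNeumann N hTN _
  have ht'N : t' ∈ N := cfc_mem_vonNeumann N hTN _
  -- Makes the errors A q m and A* t² m at most r; the summand 1 covers A = 0.
  set ε := r / (‖A‖ + 1) with hε
  have hA1 : 0 < ‖A‖ + 1 := by positivity
  have hε0 : 0 < ε := by positivity
  have hAε : ‖A‖ * ε ≤ r := by
    rw [hε, mul_div_assoc', div_le_iff₀ hA1]
    nlinarith [norm_nonneg A]
  obtain ⟨m, hmN, hm0, hm1, hqm, htm, hτm⟩ := exists_soft_complement hτ hqN hqN htN ht'N hqs hts hq0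
    ht'0 (by rw [hqi, hqi]) hte hε0
  have hmnorm : ‖m‖ ≤ 1 := (CStarAlgebra.norm_le_one_iff_of_nonneg m hm0).2 hm1
  have hAm : ‖A * m‖ ≤ 2 * r := by
    have e : A * m = A * p * m + A * (q * m) := by rw [hq]; noncomm_ring
    rw [e]
    calc _ ≤ ‖A * p * m‖ + ‖A * (q * m)‖ := norm_add_le _ _
      _ ≤ ‖A * p‖ * ‖m‖ + ‖A‖ * ‖q * m‖ := add_le_add (norm_mul_le _ _) (norm_mul_le _ _)
      _ ≤ r * 1 + ‖A‖ * ε := by gcongr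
      _ ≤ 2 * r := by linarith
  -- The factor 1 - t² vanishes where A A* ≥ 4a = 8 r², so the square of this norm is at most 8 r² ≤
  -- (3r)².
  have hAt : ‖star A * (1 - t * t)‖ ≤ 3 * r := by
    refine norm_le_of_star_mul_self_le (by positivity) ?_
    let l : ℝ → ℝ := fun x => 1 - k x * k x
    have hl : Continuous l := continuous_const.sub (hk.fun_mul hk)
    have e0 : 1 - t * t = cfc l T := by
      rw [ht, cfc_mul_cfc hk hk, ← cfc_const_one ℝ T,
        ← cfc_sub (fun _ => 1) (fun x => k x * k x) T continuousOn_const (hk.fun_mul hk).continuousOn]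
    have e : star (star A * (1 - t * t)) * (star A * (1 - t * t)) =
        cfc (fun x => l x * l x * x) T := by
      rw [← cfc_mul_self_mul_cfc hl hTsa, ← e0, star_mul, star_star, star_sub, star_mul, hts,
        star_one, hT]
      simp only [mul_assoc]
    rw [e]
    refine norm_cfc_le (by positivity) fun x hx => ?_
    have hx0 : 0 ≤ x := spectrum_nonneg_of_nonneg hT0 hx
    have hl0 : 0 ≤ l x := by
      simp only [l]; rw [hkk]; linarith [ramp_le_one (2 * a) x]
    have hl1 : l x ≤ 1 := by
      simp only [l]; rw [hkk]; linarith [ramp_nonneg (2 * a) x]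
    rw [Real.norm_of_nonneg (by positivity)]
    rcases le_total (2 * (2 * a)) x with h | h
    · have : l x = 0 := by simp only [l]; rw [hkk, ramp_eq_one (by positivity) h]; ring
      rw [this]; nlinarith [sq_nonneg r]
    · calc l x * l x * x ≤ 1 * 1 * x := by gcongr
        _ ≤ (3 * r) ^ 2 := by rw [ha] at h; nlinarith [sq_nonneg r]
  have hAm' : ‖star A * m‖ ≤ 4 * r := by
    have e : star A * m = star A * (1 - t * t) * m + star A * (t * (t * m)) := by noncomm_ring
    rw [e]
    calc _ ≤ ‖star A * (1 - t * t) * m‖ + ‖star A * (t * (t * m))‖ := norm_add_le _ _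
      _ ≤ ‖star A * (1 - t * t)‖ * ‖m‖ + ‖star A‖ * (‖t‖ * ‖t * m‖) :=
        add_le_add (norm_mul_le _ _) ((norm_mul_le _ _).trans
          (mul_le_mul_of_nonneg_left (norm_mul_le _ _) (norm_nonneg _)))
      _ ≤ (3 * r) * 1 + ‖A‖ * (1 * ε) := by rw [norm_star]; gcongr
      _ ≤ 4 * r := by linarith
  set R := (ℜ A : H →L[ℂ] H) with hR
  have hRsa : IsSelfAdjoint R := (ℜ A).2
  have hRe : R = (2 : ℝ)⁻¹ • (A + star A) := realPart_apply_coe A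
  have hRN : R ∈ N := by
    rw [hRe]; exact real_smul_mem_vonNeumann N (add_mem hA (star_mem hA)) _
  have hRm : ‖R * m‖ ≤ 3 * r := by
    rw [hRe, smul_mul_assoc, norm_smul, add_mul]
    calc ‖(2 : ℝ)⁻¹‖ * ‖A * m + star A * m‖ ≤ 2⁻¹ * (2 * r + 4 * r) := by
          rw [Real.norm_of_nonneg (by norm_num)]
          gcongr
          exact (norm_add_le _ _).trans (add_le_add hAm hAm')
      _ = 3 * r := by ring
  have h2 := trace_ramp_mul_star_le hτ hRN hmN hm0 hm1 (by positivity : 0 < 3 * r) hRm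
  have hcomp := cfc_ramp_posPart_le hRsa hr
  have hpN : R⁺ ∈ N := by
    rw [posPart_eq_cfc]
    exact cfc_mem_vonNeumann N hRN _
  -- The constant is 4 · (1 + 4): the soft complement costs τ(q) for q and 4 τ(q) for t', and the
  -- final cut-off a factor 4.
  calc τ (cfc (ramp (6 * r)) R⁺) ≤ τ (cfc (ramp (2 * (3 * r) ^ 2)) (R * star R)) :=
        hτ.mono (cfc_mem_vonNeumann N hpN _)
          (cfc_mem_vonNeumann N (mul_mem hRN (star_mem hRN)) _)
          (cfc_nonneg fun x _ => ramp_nonneg _ x) hcomp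
    _ ≤ 4 * τ (1 - m) := h2
    _ ≤ 4 * (τ q + 4 * τ q) := by gcongr; exact hτm.trans (by gcongr)
    _ = 20 * τ q := by ring

end Distribution

/-! ### Generalised singular values. -/

section SingularValue

variable {N : VonNeumannAlgebra H} {τ : (H →L[ℂ] H) → ℝ≥0∞}

theorem singularValue_bddBelow (N : VonNeumannAlgebra H) (τ : (H →L[ℂ] H) → ℝ≥0∞)
    (A : H →L[ℂ] H) (t : ℝ) :
    BddBelow {r : ℝ | ∃ p ∈ N, IsStarProjection p ∧ τ (1 - p) ≤ ENNReal.ofReal t ∧ r = ‖A * p‖} :=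
  ⟨0, by rintro r ⟨p, -, -, -, rfl⟩; exact norm_nonneg _⟩

theorem singularValue_nonneg (N : VonNeumannAlgebra H) (τ : (H →L[ℂ] H) → ℝ≥0∞)
    (A : H →L[ℂ] H) (t : ℝ) : 0 ≤ singularValue N τ A t :=
  Real.sInf_nonneg (by rintro r ⟨p, -, -, -, rfl⟩; exact norm_nonneg _)

theorem norm_mem_singularValue_set (hτ : IsFaithfulNormalSemifiniteTrace N τ) (A : H →L[ℂ] H)
    (t : ℝ) :
    ‖A‖ ∈ {r : ℝ | ∃ p ∈ N, IsStarProjection p ∧ τ (1 - p) ≤ ENNReal.ofReal t ∧ r = ‖A * p‖} :=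
  ⟨1, one_mem N, .one _, by rw [sub_self, hτ.map_zero]; exact zero_le, by rw [mul_one]⟩

theorem singularValue_le_norm (hτ : IsFaithfulNormalSemifiniteTrace N τ) (A : H →L[ℂ] H) (t : ℝ) :
    singularValue N τ A t ≤ ‖A‖ :=
  csInf_le (singularValue_bddBelow N τ A t) (norm_mem_singularValue_set hτ A t)

theorem singularValue_antitone (hτ : IsFaithfulNormalSemifiniteTrace N τ) (A : H →L[ℂ] H) :
    Antitone (singularValue N τ A) := by
  intro s t hst
  refine csInf_le_csInf (singularValue_bddBelow N τ A t) ⟨_, norm_mem_singularValue_set hτ A s⟩ ?_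
  rintro r ⟨p, hp, hpp, h, rfl⟩
  exact ⟨p, hp, hpp, h.trans (ENNReal.ofReal_le_ofReal hst), rfl⟩

theorem exists_projection_of_singularValue_lt (hτ : IsFaithfulNormalSemifiniteTrace N τ)
    {A : H →L[ℂ] H} {t r : ℝ} (h : singularValue N τ A t < r) :
    ∃ p ∈ N, IsStarProjection p ∧ τ (1 - p) ≤ ENNReal.ofReal t ∧ ‖A * p‖ < r := by
  obtain ⟨_, ⟨p, hp, hpp, ht, rfl⟩, hr⟩ :=
    exists_lt_of_csInf_lt ⟨_, norm_mem_singularValue_set hτ A t⟩ h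
  exact ⟨p, hp, hpp, ht, hr⟩

theorem singularValue_smul (N : VonNeumannAlgebra H) (τ : (H →L[ℂ] H) → ℝ≥0∞) (c : ℂ)
    (A : H →L[ℂ] H) (t : ℝ) : singularValue N τ (c • A) t = ‖c‖ * singularValue N τ A t := by
  unfold singularValue
  rw [← smul_eq_mul, ← Real.sInf_smul_of_nonneg (norm_nonneg c)]
  congr 1
  ext r
  simp only [Set.mem_smul_set, Set.mem_ofPred_eq]
  constructor
  · rintro ⟨p, hp, hpp, h, rfl⟩
    exact ⟨_, ⟨p, hp, hpp, h, rfl⟩, by rw [smul_mul_assoc, norm_smul, smul_eq_mul]⟩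
  · rintro ⟨_, ⟨p, hp, hpp, h, rfl⟩, rfl⟩
    exact ⟨p, hp, hpp, h, by rw [smul_mul_assoc, norm_smul, smul_eq_mul]⟩

theorem smul_mem_dixmierIdeal {A : H →L[ℂ] H} (hA : A ∈ dixmierIdeal N τ) (c : ℂ) :
    c • A ∈ dixmierIdeal N τ := by
  obtain ⟨hN, C, hC⟩ := hA
  refine ⟨complex_smul_mem_vonNeumann N hN c, ‖c‖ * C, fun t ht => ?_⟩
  have e : ∀ s, singularValue N τ (c • A) s = ‖c‖ * singularValue N τ A s :=
    singularValue_smul N τ c A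
  simp only [e]
  rw [intervalIntegral.integral_const_mul]
  calc _ = ‖c‖ * (1 / Real.log (1 + t) * ∫ s in (0 : ℝ)..t, singularValue N τ A s) := by ring
    _ ≤ ‖c‖ * C := mul_le_mul_of_nonneg_left (hC t ht) (norm_nonneg c)

/-- As μ is decreasing, μ(s) ≥ r would put (0, s] inside the superlevel set. So any s beyond its
measure has μ(s) < r, which supplies a projection for the previous estimate; then s decreases to
that measure. -/
theorem trace_ramp_le_volume (hτ : IsFaithfulNormalSemifiniteTrace N τ) {A : H →L[ℂ] H}
    (hA : A ∈ N) {r : ℝ} (hr : 0 < r) :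
    τ (cfc (ramp (6 * r)) (ℜ A : H →L[ℂ] H)⁺) ≤
      20 * volume {s : ℝ | 0 < s ∧ r ≤ singularValue N τ A s} := by
  set S := {s : ℝ | 0 < s ∧ r ≤ singularValue N τ A s} with hS
  by_cases hV : volume S = ∞
  · rw [hV]; simp
  have key : ∀ s : ℝ, (volume S).toReal < s →
      τ (cfc (ramp (6 * r)) (ℜ A : H →L[ℂ] H)⁺) ≤ 20 * ENNReal.ofReal s := by
    intro s hs
    have h0 : 0 < s := ENNReal.toReal_nonneg.trans_lt hs
    have hlt : singularValue N τ A s < r := by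
      by_contra hcon
      have hsub : Ioc 0 s ⊆ S := fun x hx =>
        ⟨hx.1, (not_lt.1 hcon).trans (singularValue_antitone hτ A hx.2)⟩
      have h1 : volume (Ioc 0 s) ≤ volume S := measure_mono hsub
      rw [Real.volume_Ioc, sub_zero, ENNReal.ofReal_le_iff_le_toReal hV] at h1
      linarith
    obtain ⟨p, hp, hpp, h1, h2⟩ := exists_projection_of_singularValue_lt hτ hlt
    exact (trace_ramp_posPart_realPart_le hτ hA hp hpp hr h2.le).trans (by gcongr)
  refine ENNReal.le_of_forall_pos_le_add fun ε hε _ => ?_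
  have h := key ((volume S).toReal + ε / 20) (by
    have : (0 : ℝ) < ε := hε
    linarith [div_pos this (by norm_num : (0 : ℝ) < 20)])
  refine h.trans (le_of_eq ?_)
  rw [ENNReal.ofReal_add ENNReal.toReal_nonneg (by positivity), ENNReal.ofReal_toReal hV, mul_add]
  congr 1
  rw [← ENNReal.ofReal_ofNat 20, ← ENNReal.ofReal_mul (by norm_num), mul_div_cancel₀ _ (by norm_num)]
  simp

end SingularValue

/-! ### From distribution functions to traces of functions of an operator. -/

section Layer

variable {N : VonNeumannAlgebra H} {τ : (H →L[ℂ] H) → ℝ≥0∞}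

theorem telescope_min (F : ℝ → ℝ) (a : ℕ → ℝ) (x : ℝ) (n : ℕ) :
    ∑ k ∈ Finset.range n, (F (min (a k) x) - F (min (a (k + 1)) x)) =
      F (min (a 0) x) - F (min (a n) x) :=
  Finset.sum_range_sub' (fun k => F (min (a k) x)) n

/-- Dyadic layer cake: on the spectrum, the part of F above level F(a n) is dominated by a finite
sum of ramps weighted by the increments of F along a k = R / 2^k. The hypothesis bounds each ramp by
a superlevel set of ν, and the increments telescope back to F. The factor 24 is 6 from the
distribution estimate times 4 = a k / a (k + 2). -/
theorem trace_cfc_sub_le_lintegral (hτ : IsFaithfulNormalSemifiniteTrace N τ) {B : H →L[ℂ] H}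
    (hB : B ∈ N) (hB0 : 0 ≤ B) {ν : ℝ → ℝ} (hν : Measurable ν) {K : ℝ≥0∞}
    (hD : ∀ r : ℝ, 0 < r → τ (cfc (ramp (6 * r)) B) ≤ K * volume {s : ℝ | 0 < s ∧ r ≤ ν s})
    {F : ℝ → ℝ} (hF : Continuous F) (hmono : Monotone F) (hF0 : ∀ x, 0 ≤ F x)
    {R : ℝ} (hR : ‖B‖ < R) (n : ℕ) :
    τ (cfc (fun x => max 0 (F x - F (R / 2 ^ n))) B) ≤
      K * ∫⁻ s in Ioi (0 : ℝ), ENNReal.ofReal (F (24 * ν s)) := by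
  have hR0 : 0 < R := (norm_nonneg B).trans_lt hR
  set a : ℕ → ℝ := fun n => R / 2 ^ n with ha
  have ha0 : ∀ k, 0 < a k := fun k => by positivity
  have ha2 : ∀ k, a k = 2 * a (k + 1) := fun k => by
    simp only [ha, pow_succ]; field_simp
  have hale : ∀ k, a (k + 1) ≤ a k := fun k => by linarith [ha2 k, ha0 (k + 1)]
  set c : ℕ → ℝ := fun k => F (a k) - F (a (k + 1)) with hc
  have hc0 : ∀ k, 0 ≤ c k := fun k => sub_nonneg.2 (hmono (hale k))
  let f : ℕ → ℝ → ℝ := fun k x => c k * ramp (a (k + 2)) x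
  have hf : ∀ k, Continuous (f k) := fun k => continuous_const.mul (continuous_ramp _)
  have hfN : ∀ k, cfc (f k) B ∈ N := fun k => cfc_mem_vonNeumann N hB _
  have hf0 : ∀ k, 0 ≤ cfc (f k) B := fun k =>
    cfc_nonneg fun x _ => mul_nonneg (hc0 k) (ramp_nonneg _ _)
  have hle : cfc (fun x => max 0 (F x - F (a n))) B ≤ ∑ k ∈ Finset.range n, cfc (f k) B := by
    rw [← cfc_sum f B (Finset.range n) (fun k _ => (hf k).continuousOn)]
    refine cfc_mono (fun x hx => ?_) (by fun_prop) ?_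
    · have hxR : x ≤ R := by
        have hBsa : IsSelfAdjoint B := IsSelfAdjoint.of_nonneg hB0
        exact ((le_algebraMap_iff_spectrum_le hBsa).1 hBsa.le_algebraMap_norm_self x hx).trans hR.le
      rw [Finset.sum_apply]
      refine max_le (Finset.sum_nonneg fun k _ => mul_nonneg (hc0 k) (ramp_nonneg _ _)) ?_
      have h1 := telescope_min F a x n
      have h2 : min (a 0) x = x := min_eq_right (by simpa [ha] using hxR)
      have h3 : F (min (a n) x) ≤ F (a n) := hmono (min_le_left _ _)
      rw [h2] at h1
      have h4 : ∑ k ∈ Finset.range n, (F (min (a k) x) - F (min (a (k + 1)) x)) ≤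
          ∑ k ∈ Finset.range n, f k x := by
        refine Finset.sum_le_sum fun k _ => ?_
        rcases le_total x (a (k + 1)) with h | h
        · rw [min_eq_right h, min_eq_right (h.trans (hale k)), sub_self]
          exact mul_nonneg (hc0 k) (ramp_nonneg _ _)
        · have h5 : ramp (a (k + 2)) x = 1 := ramp_eq_one (ha0 _) (by rw [← ha2 (k + 1)]; exact h)
          simp only [f]
          rw [min_eq_left h, h5, mul_one]
          exact sub_le_sub_right (hmono (min_le_left _ _)) _
      linarith
    · exact (continuous_finsetSum _ fun k _ => hf k).continuousOn.congr
        fun x _ => by rw [Finset.sum_apply]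
  have hτf : ∀ k, τ (cfc (f k) B) ≤
      K * ∫⁻ s in Ioi (0 : ℝ), ENNReal.ofReal (c k) * {s | a k ≤ 24 * ν s}.indicator 1 s := by
    intro k
    have hms : MeasurableSet {s | a k ≤ 24 * ν s} := measurableSet_le measurable_const (hν.const_mul _)
    have e1 : cfc (f k) B = ((c k).toNNReal : ℝ) • cfc (ramp (a (k + 2))) B := by
      rw [Real.coe_toNNReal _ (hc0 k)]
      exact cfc_const_mul _ _ B (continuous_ramp _).continuousOn
    rw [e1, hτ.map_smul _ _ (cfc_mem_vonNeumann N hB _) (cfc_nonneg fun x _ => ramp_nonneg _ _),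
      lintegral_const_mul _ (measurable_one.indicator hms), lintegral_indicator_one hms,
      Measure.restrict_apply hms]
    have h6 := hD (a (k + 2) / 6) (by have := ha0 (k + 2); positivity)
    have e2 : {s : ℝ | 0 < s ∧ a (k + 2) / 6 ≤ ν s} = {s | a k ≤ 24 * ν s} ∩ Ioi 0 := by
      ext s
      simp only [mem_ofPred_eq, mem_inter_iff, mem_Ioi]
      rw [and_comm]
      refine and_congr_left fun _ => ?_
      rw [ha2 k, ha2 (k + 1)]
      constructor <;> intro h <;> linarith
    rw [mul_div_cancel₀ _ (by norm_num : (6 : ℝ) ≠ 0), e2] at h6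
    calc ((c k).toNNReal : ℝ≥0∞) * τ (cfc (ramp (a (k + 2))) B)
        ≤ ENNReal.ofReal (c k) * (K * volume ({s | a k ≤ 24 * ν s} ∩ Ioi 0)) :=
          mul_le_mul_right h6 _
      _ = _ := by ring
  calc τ (cfc (fun x => max 0 (F x - F (a n))) B) ≤ τ (∑ k ∈ Finset.range n, cfc (f k) B) :=
        hτ.mono (cfc_mem_vonNeumann N hB _) (sum_mem fun k _ => hfN k)
          (cfc_nonneg fun x _ => le_max_left _ _) hle
    _ = ∑ k ∈ Finset.range n, τ (cfc (f k) B) := hτ.map_sum _ _ hfN hf0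
    _ ≤ ∑ k ∈ Finset.range n, K * ∫⁻ s in Ioi (0 : ℝ),
          ENNReal.ofReal (c k) * {s | a k ≤ 24 * ν s}.indicator 1 s :=
        Finset.sum_le_sum fun k _ => hτf k
    _ = K * ∫⁻ s in Ioi (0 : ℝ), ∑ k ∈ Finset.range n,
          ENNReal.ofReal (c k) * {s | a k ≤ 24 * ν s}.indicator 1 s := by
        rw [lintegral_finsetSum _ fun k _ => (measurable_one.indicator
          (measurableSet_le measurable_const (hν.const_mul _))).const_mul _, Finset.mul_sum]
    _ ≤ K * ∫⁻ s in Ioi (0 : ℝ), ENNReal.ofReal (F (24 * ν s)) := by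
        refine mul_le_mul_right (lintegral_mono fun s => ?_) _
        set x := 24 * ν s with hx
        have h4 : ∀ k, ENNReal.ofReal (c k) * {s | a k ≤ 24 * ν s}.indicator 1 s ≤
            ENNReal.ofReal (F (min (a k) x) - F (min (a (k + 1)) x)) := by
          intro k
          by_cases h : a k ≤ x
          · rw [indicator_of_mem (show s ∈ {s | a k ≤ 24 * ν s} from h), Pi.one_apply, mul_one,
              min_eq_left h, min_eq_left ((hale k).trans h)]
          · rw [indicator_of_notMem (show s ∉ {s | a k ≤ 24 * ν s} from h), mul_zero]
            exact zero_le
        refine (Finset.sum_le_sum fun k _ => h4 k).trans ?_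
        rw [← ENNReal.ofReal_sum_of_nonneg fun k _ => sub_nonneg.2 (hmono (min_le_min_right _ (hale k))),
          telescope_min]
        refine ENNReal.ofReal_le_ofReal ?_
        linarith [hF0 (min (a n) x), hmono (min_le_right (a 0) x)]

/-- The truncations of F(B) increase to F(B), at distance at most F(R / 2^n) → 0, so normality of
the trace passes the uniform bound to the limit. -/
theorem trace_cfc_le_lintegral (hτ : IsFaithfulNormalSemifiniteTrace N τ) {B : H →L[ℂ] H}
    (hB : B ∈ N) (hB0 : 0 ≤ B) {ν : ℝ → ℝ} (hν : Measurable ν) {K : ℝ≥0∞}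
    (hD : ∀ r : ℝ, 0 < r → τ (cfc (ramp (6 * r)) B) ≤ K * volume {s : ℝ | 0 < s ∧ r ≤ ν s})
    {F : ℝ → ℝ} (hF : Continuous F) (hmono : Monotone F) (hF0 : F 0 = 0) (hFn : ∀ x, 0 ≤ F x) :
    τ (cfc F B) ≤ K * ∫⁻ s in Ioi (0 : ℝ), ENNReal.ofReal (F (24 * ν s)) := by
  have hBsa : IsSelfAdjoint B := IsSelfAdjoint.of_nonneg hB0
  set R := ‖B‖ + 1 with hR
  have hR0 : 0 < R := by positivity
  let f : ℕ → ℝ → ℝ := fun n x => max 0 (F x - F (R / 2 ^ n))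
  have hf : ∀ n, Continuous (f n) := fun n => by fun_prop
  let S : Set (H →L[ℂ] H) := range fun n => cfc (f n) B
  have hmonoS : Monotone fun n => cfc (f n) B := by
    intro n m hnm
    refine cfc_mono (fun x _ => ?_) (hf n).continuousOn (hf m).continuousOn
    have : F (R / 2 ^ m) ≤ F (R / 2 ^ n) := hmono (by gcongr; norm_num)
    exact max_le_max le_rfl (by linarith)
  have hlim : Tendsto (fun n : ℕ => F (R / 2 ^ n)) atTop (𝓝 0) := by
    have h1 : Tendsto (fun n : ℕ => R / 2 ^ n) atTop (𝓝 0) := by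
      have := (tendsto_pow_atTop_nhds_zero_of_lt_one (r := (1 / 2 : ℝ)) (by norm_num)
        (by norm_num)).const_mul R
      simpa [div_eq_mul_inv] using this
    have h2 := (hF.tendsto 0).comp h1
    rwa [hF0] at h2
  have hlub : IsLUB S (cfc F B) := by
    constructor
    · rintro _ ⟨n, rfl⟩
      exact cfc_mono (fun x _ => max_le (hFn x) (by linarith [hFn (R / 2 ^ n)]))
        (hf n).continuousOn hF.continuousOn
    · intro b hb
      have h1 : ∀ n : ℕ, cfc F B ≤ b + algebraMap ℝ (H →L[ℂ] H) (F (R / 2 ^ n)) := by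
        intro n
        have h2 : cfc F B ≤ cfc (fun x => f n x + F (R / 2 ^ n)) B := by
          refine cfc_mono (fun x _ => ?_) hF.continuousOn ((hf n).add continuous_const).continuousOn
          linarith [le_max_right 0 (F x - F (R / 2 ^ n))]
        rw [cfc_add_const _ (f n) B (hf n).continuousOn hBsa] at h2
        exact h2.trans (add_le_add_left (hb ⟨n, rfl⟩) _)
      have h3 : Tendsto (fun n : ℕ => b + algebraMap ℝ (H →L[ℂ] H) (F (R / 2 ^ n))) atTop
          (𝓝 (b + algebraMap ℝ (H →L[ℂ] H) 0)) :=
        tendsto_const_nhds.add (((algebraMapCLM ℝ (H →L[ℂ] H)).continuous.tendsto 0).comp hlim)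
      rw [_root_.map_zero, add_zero] at h3
      exact ge_of_tendsto' h3 h1
  rw [hτ.normal S (range_nonempty _) ?_ ?_ _ (cfc_mem_vonNeumann N hB _) hlub]
  · refine iSup₂_le ?_
    rintro _ ⟨n, rfl⟩
    exact trace_cfc_sub_le_lintegral hτ hB hB0 hν hD hF hmono hFn (by linarith) n
  · rintro _ ⟨n, rfl⟩
    exact ⟨cfc_mem_vonNeumann N hB _, cfc_nonneg fun x _ => le_max_left _ _⟩
  · exact directedOn_range.2 hmonoS.directed_le

end Layer

/-! ### The function `exp (-x ^ (-q))` -/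

theorem expNegPow_nonneg (q x : ℝ) : 0 ≤ expNegPow q x := by
  unfold expNegPow; split_ifs <;> positivity

theorem expNegPow_of_nonpos (q : ℝ) {x : ℝ} (hx : x ≤ 0) : expNegPow q x = 0 :=
  if_neg (not_lt.2 hx)

theorem expNegPow_le_one (q x : ℝ) : expNegPow q x ≤ 1 := by
  unfold expNegPow
  split_ifs with h
  · rw [Real.exp_le_one_iff]
    have := Real.rpow_nonneg h.le (-q)
    linarith
  · exact zero_le_one

theorem monotone_expNegPow {q : ℝ} (hq : 0 < q) : Monotone (expNegPow q) := by
  intro x y hxy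
  rcases le_or_gt x 0 with h | h
  · rw [expNegPow_of_nonpos q h]; exact expNegPow_nonneg q y
  · unfold expNegPow
    rw [if_pos h, if_pos (h.trans_le hxy), Real.exp_le_exp, neg_le_neg_iff]
    exact Real.rpow_le_rpow_of_nonpos h hxy (by linarith)

/-- From exp(v) ≥ v^j / j! with v = x^(-q) and q j ≥ 4. The fourth power is what makes μ⁴ integrable
later on. -/
theorem exists_expNegPow_le {q : ℝ} (hq : 0 < q) :
    ∃ K : ℝ, 1 ≤ K ∧ ∀ x, expNegPow q x ≤ K * x ^ 4 := by
  obtain ⟨j, hj⟩ := exists_nat_ge (4 / q)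
  have hjq : 4 ≤ q * j := by
    rw [div_le_iff₀ hq] at hj; linarith
  have hK : (1 : ℝ) ≤ j.factorial := by exact_mod_cast Nat.one_le_iff_ne_zero.2 j.factorial_ne_zero
  refine ⟨j.factorial, hK, fun x => ?_⟩
  rcases le_or_gt x 0 with h | h
  · rw [expNegPow_of_nonpos q h]; positivity
  rcases le_or_gt 1 x with h1 | h1
  · calc expNegPow q x ≤ 1 := expNegPow_le_one q x
      _ ≤ 1 * 1 ^ 4 := by norm_num
      _ ≤ j.factorial * x ^ 4 := by gcongr
  · unfold expNegPow
    rw [if_pos h]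
    set v := x ^ (-q) with hv
    have hv0 : 0 < v := Real.rpow_pos_of_pos h _
    have h2 : v ^ j / j.factorial ≤ Real.exp v := Real.pow_div_factorial_le_exp v hv0.le j
    have h3 : v ^ j * x ^ (q * j) = 1 := by
      rw [hv, ← Real.rpow_natCast, ← Real.rpow_mul h.le, ← Real.rpow_add h]
      simp
    have h4 : x ^ (q * j) ≤ x ^ 4 := by
      have := Real.rpow_le_rpow_of_exponent_ge h h1.le hjq
      exact_mod_cast this
    rw [Real.exp_neg, inv_le_iff_one_le_mul₀ (Real.exp_pos _)]
    calc (1 : ℝ) = v ^ j * x ^ (q * j) := h3.symm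
      _ ≤ v ^ j * x ^ 4 := by gcongr
      _ = j.factorial * x ^ 4 * (v ^ j / j.factorial) := by field_simp
      _ ≤ j.factorial * x ^ 4 * Real.exp v := by gcongr

theorem continuous_expNegPow {q : ℝ} (hq : 0 < q) : Continuous (expNegPow q) := by
  obtain ⟨K, -, hK⟩ := exists_expNegPow_le hq
  rw [continuous_iff_continuousAt]
  intro x
  rcases lt_trichotomy x 0 with h | rfl | h
  · have : expNegPow q =ᶠ[𝓝 x] fun _ => 0 := by
      filter_upwards [gt_mem_nhds h] with y hy using expNegPow_of_nonpos q hy.le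
    exact continuousAt_const.congr this.symm
  · have h0 : expNegPow q 0 = 0 := expNegPow_of_nonpos q le_rfl
    unfold ContinuousAt
    rw [h0]
    have h1 : Tendsto (fun x : ℝ => K * x ^ 4) (𝓝 0) (𝓝 0) := by
      have : Continuous fun x : ℝ => K * x ^ 4 := by fun_prop
      simpa using this.tendsto 0
    exact tendsto_of_tendsto_of_tendsto_of_le_of_le tendsto_const_nhds h1
      (fun x => expNegPow_nonneg q x) hK
  · have : expNegPow q =ᶠ[𝓝 x] fun y => Real.exp (-(y ^ (-q))) := by
      filter_upwards [lt_mem_nhds h] with y hy using if_pos hy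
    refine ContinuousAt.congr ?_ this.symm
    exact (((Real.continuousAt_rpow_const x (-q) (Or.inl h.ne')).neg).rexp)

theorem expNegPow_le_rational {q K : ℝ} (hK1 : 1 ≤ K) (hK : ∀ x, expNegPow q x ≤ K * x ^ 4)
    (v : ℝ) : expNegPow q v ≤ 2 * K * v ^ 2 * (1 + v ^ 2)⁻¹ := by
  rw [le_mul_inv_iff₀ (by positivity)]
  have h1 := hK v
  have h2 := expNegPow_le_one q v
  have h0 := expNegPow_nonneg q v
  rcases le_total (v ^ 2) 1 with h | h
  · have h3 : K * v ^ 4 ≤ K * v ^ 2 := by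
      have : v ^ 4 = v ^ 2 * v ^ 2 := by ring
      rw [this]; gcongr; nlinarith [sq_nonneg v]
    nlinarith
  · have : expNegPow q v * (1 + v ^ 2) ≤ 1 * (1 + v ^ 2) := by gcongr
    nlinarith

/-- Comparison with 1/(1 + (at)²), whose integral is π/a. Linearity of the bound in a is the point:
after Tonelli it leaves ∫ ν. -/
theorem lintegral_expNegPow_div_sq_le {q K : ℝ} (hK1 : 1 ≤ K)
    (hK : ∀ x, expNegPow q x ≤ K * x ^ 4) {a : ℝ} (ha : 0 ≤ a) (S : Set ℝ) (hS : S ⊆ Ioi 0)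
    (hSm : MeasurableSet S) :
    ∫⁻ t in S, ENNReal.ofReal (expNegPow q (t * a) * (t ^ 2)⁻¹) ≤
      ENNReal.ofReal (2 * K * Real.pi * a) := by
  rcases ha.eq_or_lt with rfl | ha
  · simp [expNegPow_of_nonpos]
  have hle : ∀ t ∈ S, ENNReal.ofReal (expNegPow q (t * a) * (t ^ 2)⁻¹) ≤
      ENNReal.ofReal (2 * K * a ^ 2 * (1 + (a * t) ^ 2)⁻¹) := by
    intro t ht
    have ht0 : 0 < t := hS ht
    refine ENNReal.ofReal_le_ofReal ?_
    have h := expNegPow_le_rational hK1 hK (t * a)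
    calc expNegPow q (t * a) * (t ^ 2)⁻¹
        ≤ 2 * K * (t * a) ^ 2 * (1 + (t * a) ^ 2)⁻¹ * (t ^ 2)⁻¹ := by gcongr
      _ = 2 * K * a ^ 2 * (1 + (a * t) ^ 2)⁻¹ := by
        rw [mul_comm t a]; field_simp
  have hint : Integrable fun t : ℝ => 2 * K * a ^ 2 * (1 + (a * t) ^ 2)⁻¹ :=
    (integrable_inv_one_add_sq.comp_mul_left' ha.ne').const_mul _
  calc _ ≤ ∫⁻ t in S, ENNReal.ofReal (2 * K * a ^ 2 * (1 + (a * t) ^ 2)⁻¹) :=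
        setLIntegral_mono' hSm hle
    _ ≤ ∫⁻ t, ENNReal.ofReal (2 * K * a ^ 2 * (1 + (a * t) ^ 2)⁻¹) := setLIntegral_le_lintegral _ _
    _ = ENNReal.ofReal (∫ t, 2 * K * a ^ 2 * (1 + (a * t) ^ 2)⁻¹) := by
        rw [ofReal_integral_eq_lintegral_ofReal hint (Eventually.of_forall fun t => by positivity)]
    _ = ENNReal.ofReal (2 * K * Real.pi * a) := by
        congr 1
        rw [integral_const_mul, Measure.integral_comp_mul_left (fun t : ℝ => (1 + t ^ 2)⁻¹) a,
          integral_univ_inv_one_add_sq, abs_of_pos (inv_pos.2 ha), smul_eq_mul]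
        field_simp

/-! ### Integrals of decreasing functions of logarithmic growth -/

theorem log_one_add_le_two_mul_sqrt {s : ℝ} (hs : 0 < s) : Real.log (1 + s) ≤ 2 * √s := by
  have h1 : Real.log (1 + s) = 2 * Real.log (√(1 + s)) := by
    rw [Real.log_sqrt (by positivity)]; ring
  have h2 : Real.log (√(1 + s)) ≤ √(1 + s) - 1 := Real.log_le_sub_one_of_pos (by positivity)
  have h3 : √(1 + s) ≤ 1 + √s := by
    rw [Real.sqrt_le_left (by positivity)]
    nlinarith [Real.sq_sqrt hs.le, Real.sqrt_nonneg s]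
  linarith

/-- Monotonicity gives s ν(s) ≤ ∫_0^s ν ≤ C log(1 + s) ≤ 2 C √s, hence ν(s) ≤ 2 C / √s. -/
theorem antitone_pow_four_le {ν : ℝ → ℝ} (hν : Antitone ν) (hν0 : ∀ s, 0 ≤ ν s) {C : ℝ}
    (hC : ∀ t, 0 < t → ∫ s in (0 : ℝ)..t, ν s ≤ C * Real.log (1 + t)) (hC0 : 0 ≤ C) {s : ℝ}
    (hs : 0 < s) : ν s ^ 4 ≤ 16 * C ^ 4 * (s ^ 2)⁻¹ := by
  have h1 : s * ν s ≤ ∫ x in (0 : ℝ)..s, ν x := by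
    have h2 : ∫ _x in (0 : ℝ)..s, ν s = s * ν s := by simp
    rw [← h2]
    exact intervalIntegral.integral_mono_on hs.le (by simp) hν.intervalIntegrable
      fun x hx => hν hx.2
  have h3 : s * ν s ≤ 2 * C * √s := by
    refine (h1.trans (hC s hs)).trans ?_
    have := mul_le_mul_of_nonneg_left (log_one_add_le_two_mul_sqrt hs) hC0
    linarith
  have h4 : (s * ν s) ^ 4 ≤ (2 * C * √s) ^ 4 := pow_le_pow_left₀ (mul_nonneg hs.le (hν0 s)) h3 4
  have h5 : (√s) ^ 4 = s ^ 2 := by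
    have : (√s) ^ 4 = (√s ^ 2) ^ 2 := by ring
    rw [this, Real.sq_sqrt hs.le]
  have h6 : s ^ 4 * ν s ^ 4 ≤ 16 * C ^ 4 * s ^ 2 := by
    calc s ^ 4 * ν s ^ 4 = (s * ν s) ^ 4 := by ring
      _ ≤ _ := h4
      _ = 16 * C ^ 4 * √s ^ 4 := by ring
      _ = _ := by rw [h5]
  rw [← div_eq_mul_inv, le_div_iff₀ (by positivity)]
  have h7 : 0 < s ^ 2 := by positivity
  have h8 : s ^ 2 * (ν s ^ 4 * s ^ 2) ≤ s ^ 2 * (16 * C ^ 4) := by nlinarith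
  exact le_of_mul_le_mul_left h8 h7

theorem lintegral_pow_four_lt_top {ν : ℝ → ℝ} (hν : Antitone ν) (hν0 : ∀ s, 0 ≤ ν s) {M : ℝ}
    (hM : ∀ s, ν s ≤ M) {C : ℝ}
    (hC : ∀ t, 0 < t → ∫ s in (0 : ℝ)..t, ν s ≤ C * Real.log (1 + t)) (hC0 : 0 ≤ C) :
    ∫⁻ s in Ioi (0 : ℝ), ENNReal.ofReal (ν s ^ 4) < ∞ := by
  have hint : Integrable fun s : ℝ => (M ^ 4 + 16 * C ^ 4) * (1 + s ^ 2)⁻¹ :=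
    integrable_inv_one_add_sq.const_mul _
  refine lt_of_le_of_lt (b := ∫⁻ s, ENNReal.ofReal ((M ^ 4 + 16 * C ^ 4) * (1 + s ^ 2)⁻¹)) ?_
    hint.lintegral_lt_top
  refine le_trans (setLIntegral_mono' measurableSet_Ioi fun s hs => ?_)
    (setLIntegral_le_lintegral _ _)
  refine ENNReal.ofReal_le_ofReal ?_
  rw [le_mul_inv_iff₀ (by positivity), mul_add, mul_one]
  have h1 := antitone_pow_four_le hν hν0 hC hC0 hs
  have hs' : (0 : ℝ) < s ^ 2 := by have : (0 : ℝ) < s := hs; positivity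
  rw [← div_eq_mul_inv, le_div_iff₀ hs'] at h1
  exact add_le_add (pow_le_pow_left₀ (hν0 s) (hM s) 4) h1

theorem lintegral_Ioi_const_mul_inv_sq {c X : ℝ} (hc : 0 ≤ c) (hX : 0 < X) :
    ∫⁻ s in Ioi X, ENNReal.ofReal (c * (s ^ 2)⁻¹) = ENNReal.ofReal (c * X⁻¹) := by
  have hint : IntegrableOn (fun s : ℝ => c * s ^ (-2 : ℝ)) (Ioi X) :=
    (integrableOn_Ioi_rpow_of_lt (by norm_num) hX).const_mul _
  have e : ∀ s ∈ Ioi X, c * (s ^ 2)⁻¹ = c * s ^ (-2 : ℝ) := fun s hs => by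
    have hs0 : 0 < s := hX.trans hs
    rw [Real.rpow_neg hs0.le]
    norm_cast
  calc _ = ∫⁻ s in Ioi X, ENNReal.ofReal (c * s ^ (-2 : ℝ)) :=
        setLIntegral_congr_fun measurableSet_Ioi fun s hs => by simp only [e s hs]
    _ = ENNReal.ofReal (∫ s in Ioi X, c * s ^ (-2 : ℝ)) := by
        rw [ofReal_integral_eq_lintegral_ofReal hint]
        filter_upwards [ae_restrict_mem measurableSet_Ioi] with s hs
        have hs0 : 0 < s := hX.trans hs
        positivity
    _ = ENNReal.ofReal (c * X⁻¹) := by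
        congr 1
        rw [integral_const_mul, integral_Ioi_rpow_of_lt (by norm_num) hX]
        norm_num
        left
        rw [Real.rpow_neg_one]

theorem lintegral_pow_four_Ioi_le {ν : ℝ → ℝ} (hν : Antitone ν) (hν0 : ∀ s, 0 ≤ ν s) {C : ℝ}
    (hC : ∀ t, 0 < t → ∫ s in (0 : ℝ)..t, ν s ≤ C * Real.log (1 + t)) (hC0 : 0 ≤ C) {X : ℝ}
    (hX : 0 < X) :
    ∫⁻ s in Ioi X, ENNReal.ofReal (ν s ^ 4) ≤ ENNReal.ofReal (16 * C ^ 4 * X⁻¹) := by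
  rw [← lintegral_Ioi_const_mul_inv_sq (by positivity) hX]
  exact setLIntegral_mono' measurableSet_Ioi fun s hs => ENNReal.ofReal_le_ofReal
    (antitone_pow_four_le hν hν0 hC hC0 (hX.trans hs))

/-! ### Bounds for the trace of the heat operator -/

section Heat

variable {N : VonNeumannAlgebra H} {τ : (H →L[ℂ] H) → ℝ≥0∞}

theorem heatOp_eq {q : ℝ} (hq : 0 < q) {B : H →L[ℂ] H} (hB : IsSelfAdjoint B) (t : ℝ) :
    heatOp q B t = cfc (fun x => expNegPow q (t * x)) B :=
  (cfc_comp_const_mul t (expNegPow q) B (continuous_expNegPow hq).continuousOn hB).symm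

theorem heatOp_nonneg (q : ℝ) (B : H →L[ℂ] H) (t : ℝ) : 0 ≤ heatOp q B t :=
  cfc_nonneg fun x _ => expNegPow_nonneg q x

theorem heatOp_mem (q : ℝ) {B : H →L[ℂ] H} (hB : B ∈ N) (t : ℝ) : heatOp q B t ∈ N :=
  cfc_mem_vonNeumann N (real_smul_mem_vonNeumann N hB t) _

theorem monotone_trace_heatOp (hτ : IsFaithfulNormalSemifiniteTrace N τ) {q : ℝ} (hq : 0 < q)
    {B : H →L[ℂ] H} (hB : B ∈ N) (hB0 : 0 ≤ B) : Monotone fun t => τ (heatOp q B t) := by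
  intro s t hst
  refine hτ.mono (heatOp_mem q hB s) (heatOp_mem q hB t) (heatOp_nonneg q B s) ?_
  have hsa := IsSelfAdjoint.of_nonneg hB0
  have hc := continuous_expNegPow hq
  rw [heatOp_eq hq hsa, heatOp_eq hq hsa]
  refine cfc_mono (fun x hx => ?_) (by fun_prop) (by fun_prop)
  exact monotone_expNegPow hq (mul_le_mul_of_nonneg_right hst (spectrum_nonneg_of_nonneg hB0 hx))

theorem posPart_realPart_mem {A : H →L[ℂ] H} (hA : A ∈ N) : (ℜ A : H →L[ℂ] H)⁺ ∈ N := by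
  rw [posPart_eq_cfc]
  refine cfc_mem_vonNeumann N ?_ _
  rw [realPart_apply_coe]
  exact real_smul_mem_vonNeumann N (add_mem hA (star_mem hA)) _

theorem trace_heatOp_le_lintegral (hτ : IsFaithfulNormalSemifiniteTrace N τ) {q : ℝ} (hq : 0 < q)
    {A : H →L[ℂ] H} (hA : A ∈ N) {t : ℝ} (ht : 0 ≤ t) :
    τ (heatOp q (ℜ A : H →L[ℂ] H)⁺ t) ≤
      20 * ∫⁻ s in Ioi (0 : ℝ), ENNReal.ofReal (expNegPow q (t * (24 * singularValue N τ A s))) := by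
  have hB0 := CFC.posPart_nonneg (ℜ A : H →L[ℂ] H)
  rw [heatOp_eq hq (IsSelfAdjoint.of_nonneg hB0)]
  have hc := continuous_expNegPow hq
  exact trace_cfc_le_lintegral hτ (posPart_realPart_mem hA) hB0
    (singularValue_antitone hτ A).measurable (fun r hr => trace_ramp_le_volume hτ hA hr)
    (F := fun x => expNegPow q (t * x)) (by fun_prop)
    ((monotone_expNegPow hq).comp (monotone_mul_left_of_nonneg ht))
    (by simp [expNegPow_of_nonpos]) fun x => expNegPow_nonneg q _

theorem exists_integral_singularValue_le {A : H →L[ℂ] H} (hA : A ∈ dixmierIdeal N τ) :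
    ∃ C : ℝ, 0 ≤ C ∧
      ∀ t, 0 < t → ∫ s in (0 : ℝ)..t, singularValue N τ A s ≤ C * Real.log (1 + t) := by
  obtain ⟨C, hC⟩ := hA.2
  refine ⟨max C 0, le_max_right _ _, fun t ht => ?_⟩
  have hlog : 0 < Real.log (1 + t) := Real.log_pos (by linarith)
  have h := (hC t ht).trans (le_max_left C 0)
  rw [one_div, inv_mul_le_iff₀ hlog] at h
  linarith

theorem lintegral_expNegPow_mul_le {q K : ℝ} (hK1 : 1 ≤ K) (hK : ∀ x, expNegPow q x ≤ K * x ^ 4)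
    {ν : ℝ → ℝ} (hν : Measurable ν) (t : ℝ) (S : Set ℝ) :
    ∫⁻ s in S, ENNReal.ofReal (expNegPow q (t * (24 * ν s))) ≤
      ENNReal.ofReal (K * 24 ^ 4 * t ^ 4) * ∫⁻ s in S, ENNReal.ofReal (ν s ^ 4) := by
  rw [← lintegral_const_mul _ (hν.pow_const 4).ennreal_ofReal]
  refine lintegral_mono fun s => ?_
  rw [← ENNReal.ofReal_mul (by positivity)]
  refine ENNReal.ofReal_le_ofReal ((hK _).trans_eq ?_)
  ring

theorem exists_trace_heatOp_le (hτ : IsFaithfulNormalSemifiniteTrace N τ) {q : ℝ} (hq : 0 < q)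
    {A : H →L[ℂ] H} (hA : A ∈ dixmierIdeal N τ) :
    ∃ K : ℝ, 0 ≤ K ∧ ∀ t, 0 ≤ t →
      τ (heatOp q (ℜ A : H →L[ℂ] H)⁺ t) ≤ ENNReal.ofReal (K * t ^ 4) := by
  obtain ⟨K, hK1, hK⟩ := exists_expNegPow_le hq
  obtain ⟨C, hC0, hC⟩ := exists_integral_singularValue_le hA
  have hν := singularValue_antitone hτ A
  have hfin := lintegral_pow_four_lt_top hν (singularValue_nonneg N τ A)
    (singularValue_le_norm hτ A) hC hC0
  set I := ∫⁻ s in Ioi (0 : ℝ), ENNReal.ofReal (singularValue N τ A s ^ 4)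
  refine ⟨20 * (K * 24 ^ 4) * I.toReal, by positivity, fun t ht => ?_⟩
  refine (trace_heatOp_le_lintegral hτ hq hA.1 ht).trans ?_
  calc _ ≤ 20 * (ENNReal.ofReal (K * 24 ^ 4 * t ^ 4) * I) := by
        gcongr
        exact lintegral_expNegPow_mul_le hK1 hK hν.measurable t _
    _ = ENNReal.ofReal (20 * (K * 24 ^ 4) * I.toReal * t ^ 4) := by
        nth_rw 1 [← ENNReal.ofReal_toReal hfin.ne]
        rw [← ENNReal.ofReal_mul (by positivity), ← ENNReal.ofReal_ofNat 20,
          ← ENNReal.ofReal_mul (by norm_num)]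
        congr 1
        ring

theorem lintegral_swap_expNegPow_le {q K : ℝ} (hq : 0 < q) (hK1 : 1 ≤ K)
    (hK : ∀ x, expNegPow q x ≤ K * x ^ 4) {ν : ℝ → ℝ} (hν : Antitone ν) (hν0 : ∀ s, 0 ≤ ν s)
    (T : ℝ) {X : ℝ} (hX : 0 < X) :
    ∫⁻ t in Ioc 1 T, ∫⁻ s in Ioc 0 X,
        ENNReal.ofReal (expNegPow q (t * (24 * ν s)) * (t ^ 2)⁻¹) ≤
      ENNReal.ofReal (48 * K * Real.pi * ∫ s in (0 : ℝ)..X, ν s) := by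
  have hm := (continuous_expNegPow hq).measurable
  have hνm := hν.measurable
  rw [lintegral_lintegral_swap (by
    refine Measurable.aemeasurable ?_
    refine Measurable.ennreal_ofReal (Measurable.mul (hm.comp ?_) ?_)
    · exact measurable_fst.mul ((hνm.comp measurable_snd).const_mul _)
    · exact (measurable_fst.pow_const 2).inv)]
  have hint : IntervalIntegrable ν volume 0 X := hν.intervalIntegrable
  rw [← intervalIntegral.integral_const_mul, intervalIntegral.integral_of_le hX.le,
    ofReal_integral_eq_lintegral_ofReal (hint.1.const_mul _)
      (Eventually.of_forall fun s => mul_nonneg (by positivity) (hν0 s))]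
  refine lintegral_mono fun s => ?_
  refine (lintegral_expNegPow_div_sq_le hK1 hK (mul_nonneg (by norm_num) (hν0 s)) (Ioc 1 T)
    (fun x hx => zero_lt_one.trans hx.1) measurableSet_Ioc).trans_eq ?_
  congr 1
  ring

/-- The s-integral is split at X = T⁴. Beyond X the fourth-power bound contributes at most a
constant times t⁴ / X ≤ 1; below X, Tonelli leaves ∫_0^X μ, of order log(1 + T⁴) ≤ 5 log T. -/
theorem exists_lintegral_trace_heatOp_le (hτ : IsFaithfulNormalSemifiniteTrace N τ) {q : ℝ}
    (hq : 0 < q) {A : H →L[ℂ] H} (hA : A ∈ dixmierIdeal N τ) :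
    ∃ K : ℝ, 0 ≤ K ∧ ∀ T, Real.exp 1 ≤ T →
      ∫⁻ t in Ioc 1 T, τ (heatOp q (ℜ A : H →L[ℂ] H)⁺ t) * ENNReal.ofReal (t ^ 2)⁻¹ ≤
        ENNReal.ofReal (K * Real.log T) := by
  obtain ⟨K, hK1, hK⟩ := exists_expNegPow_le hq
  obtain ⟨C, hC0, hC⟩ := exists_integral_singularValue_le hA
  have hν := singularValue_antitone hτ A
  have hν0 := singularValue_nonneg N τ A
  set ν := singularValue N τ A
  have hνm := hν.measurable
  have hpi := Real.pi_pos
  set E := K * 24 ^ 4 * (16 * C ^ 4) with hE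
  refine ⟨20 * (48 * K * Real.pi * (C * 5) + E), by positivity, fun T hT => ?_⟩
  have hT2 : 2 ≤ T := by
    have := Real.add_one_le_exp 1
    linarith
  have hlogT : 1 ≤ Real.log T := by
    rwa [Real.le_log_iff_exp_le (by linarith)]
  set X := T ^ 4 with hX
  have hX0 : 0 < X := by positivity
  have hpt : ∀ t ∈ Ioc 1 T, τ (heatOp q (ℜ A : H →L[ℂ] H)⁺ t) * ENNReal.ofReal (t ^ 2)⁻¹ ≤
      20 * ((∫⁻ s in Ioc 0 X, ENNReal.ofReal (expNegPow q (t * (24 * ν s)) * (t ^ 2)⁻¹)) +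
        ENNReal.ofReal (E * (t ^ 2)⁻¹)) := by
    intro t ht
    have ht0 : 0 < t := zero_lt_one.trans ht.1
    have h1 := trace_heatOp_le_lintegral hτ hq hA.1 ht0.le
    rw [← Ioc_union_Ioi_eq_Ioi hX0.le, lintegral_union measurableSet_Ioi
      (Set.Ioc_disjoint_Ioi le_rfl)] at h1
    have h2 : ∫⁻ s in Ioi X, ENNReal.ofReal (expNegPow q (t * (24 * ν s))) ≤ ENNReal.ofReal E := by
      refine (lintegral_expNegPow_mul_le hK1 hK hνm t _).trans ?_
      refine (mul_le_mul_right (lintegral_pow_four_Ioi_le hν hν0 hC hC0 hX0) _).trans ?_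
      rw [← ENNReal.ofReal_mul (by positivity)]
      refine ENNReal.ofReal_le_ofReal ?_
      have h3 : t ^ 4 * X⁻¹ ≤ 1 := by
        rw [← div_eq_mul_inv, div_le_one hX0]
        exact pow_le_pow_left₀ ht0.le ht.2 4
      calc _ = E * (t ^ 4 * X⁻¹) := by rw [hE]; ring
        _ ≤ E * 1 := by gcongr
        _ = E := mul_one E
    have h3 : ∫⁻ s in Ioc 0 X, ENNReal.ofReal (expNegPow q (t * (24 * ν s)) * (t ^ 2)⁻¹) =
        (∫⁻ s in Ioc 0 X, ENNReal.ofReal (expNegPow q (t * (24 * ν s)))) *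
          ENNReal.ofReal (t ^ 2)⁻¹ := by
      rw [← lintegral_mul_const' _ _ ENNReal.ofReal_ne_top]
      refine lintegral_congr fun s => ?_
      rw [ENNReal.ofReal_mul (expNegPow_nonneg _ _)]
    rw [h3, ENNReal.ofReal_mul (by positivity), ← add_mul, ← mul_assoc]
    gcongr
    exact h1.trans (by gcongr)
  have hmeas : Measurable fun t : ℝ => ENNReal.ofReal (E * (t ^ 2)⁻¹) := by fun_prop
  calc _ ≤ ∫⁻ t in Ioc 1 T, 20 *
          ((∫⁻ s in Ioc 0 X, ENNReal.ofReal (expNegPow q (t * (24 * ν s)) * (t ^ 2)⁻¹)) +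
            ENNReal.ofReal (E * (t ^ 2)⁻¹)) := setLIntegral_mono' measurableSet_Ioc hpt
    _ = 20 * ((∫⁻ t in Ioc 1 T, ∫⁻ s in Ioc 0 X,
            ENNReal.ofReal (expNegPow q (t * (24 * ν s)) * (t ^ 2)⁻¹)) +
          ∫⁻ t in Ioc 1 T, ENNReal.ofReal (E * (t ^ 2)⁻¹)) := by
        rw [lintegral_const_mul' _ _ (by norm_num), lintegral_add_right _ hmeas]
    _ ≤ 20 * (ENNReal.ofReal (48 * K * Real.pi * (C * (5 * Real.log T))) +
          ENNReal.ofReal (E * Real.log T)) := by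
        gcongr
        · refine (lintegral_swap_expNegPow_le hq hK1 hK hν hν0 T hX0).trans ?_
          refine ENNReal.ofReal_le_ofReal ?_
          have h4 : Real.log (1 + X) ≤ 5 * Real.log T := by
            have h5 : 5 * Real.log T = Real.log (T ^ 5) := by rw [Real.log_pow]; norm_num
            rw [h5]
            refine Real.log_le_log (by positivity) ?_
            have h6 : T ^ 5 = T * X := by rw [hX]; ring
            have h7 : 1 ≤ X := one_le_pow₀ (by linarith)
            nlinarith
          have h8 := (hC X hX0).trans (mul_le_mul_of_nonneg_left h4 hC0)
          exact mul_le_mul_of_nonneg_left h8 (by positivity)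
        · refine (lintegral_mono_set Ioc_subset_Ioi_self).trans ?_
          rw [lintegral_Ioi_const_mul_inv_sq (by positivity) zero_lt_one]
          refine ENNReal.ofReal_le_ofReal ?_
          have hE0 : 0 ≤ E := by positivity
          nlinarith
    _ = _ := by
        have hE0 : 0 ≤ E := by positivity
        rw [← ENNReal.ofReal_add (by positivity) (by positivity), ← ENNReal.ofReal_ofNat 20,
          ← ENNReal.ofReal_mul (by norm_num)]
        congr 1
        ring

end Heat

/-! ### Functions with bounded logarithmic means -/

/-- Nonnegative functions on `(0, ∞)` of cubic growth whose logarithmic means are bounded. -/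
structure HasLogMean (h : ℝ → ℝ) : Prop where
  measurable : Measurable h
  nonneg : ∀ t, 0 < t → 0 ≤ h t
  cubic : ∃ K : ℝ, 0 ≤ K ∧ ∀ t, 0 < t → h t ≤ K * t ^ 3
  logMean : ∃ C : ℝ, ∀ T, Real.exp 1 ≤ T → ∫ s in (1 : ℝ)..T, h s / s ≤ C * Real.log T

namespace HasLogMean

variable {h : ℝ → ℝ}

theorem div_le (hh : HasLogMean h) :
    ∃ K : ℝ, 0 ≤ K ∧ ∀ t, 0 < t → h t / t ≤ K * t ^ 2 := by
  obtain ⟨K, hK0, hK⟩ := hh.cubic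
  refine ⟨K, hK0, fun t ht => ?_⟩
  rw [div_le_iff₀ ht]
  exact (hK t ht).trans_eq (by ring)

theorem uIoc_pos {a b s : ℝ} (ha : 0 < a) (hb : 0 < b) (hs : s ∈ uIoc a b) : 0 < s :=
  (lt_min ha hb).trans hs.1

theorem intervalIntegrable (hh : HasLogMean h) {a b : ℝ} (ha : 0 < a) (hb : 0 < b) :
    IntervalIntegrable (fun s => h s / s) volume a b := by
  obtain ⟨K, hK0, hK⟩ := hh.div_le
  have hc : Continuous fun s : ℝ => K * s ^ 2 := by fun_prop
  refine (hc.intervalIntegrable a b).mono_fun' (hh.measurable.div measurable_id).aestronglyMeasurable ?_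
  filter_upwards [ae_restrict_mem measurableSet_uIoc] with s hs
  have hs0 := uIoc_pos ha hb hs
  rw [Real.norm_of_nonneg (div_nonneg (hh.nonneg s hs0) hs0.le)]
  exact hK s hs0

theorem integral_mono_right (hh : HasLogMean h) {a b : ℝ} (ha : 0 < a) (hab : a ≤ b) :
    ∫ s in (1 : ℝ)..a, h s / s ≤ ∫ s in (1 : ℝ)..b, h s / s := by
  have hb := ha.trans_le hab
  rw [← intervalIntegral.integral_add_adjacent_intervals (hh.intervalIntegrable zero_lt_one ha)
    (hh.intervalIntegrable ha hb)]
  have : 0 ≤ ∫ s in a..b, h s / s := intervalIntegral.integral_nonneg hab fun s hs =>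
    div_nonneg (hh.nonneg s (ha.trans_le hs.1)) (ha.trans_le hs.1).le
  linarith

theorem integral_nonneg (hh : HasLogMean h) {a : ℝ} (ha : 1 ≤ a) :
    0 ≤ ∫ s in (1 : ℝ)..a, h s / s := by
  have := hh.integral_mono_right zero_lt_one ha
  rwa [intervalIntegral.integral_same] at this

theorem measurable_cesaro (hh : HasLogMean h) : Measurable (cesaro h) := by
  obtain ⟨K, hK0, hK⟩ := hh.div_le
  -- Extending by zero makes the integrand integrable on every interval, so its primitive is
  -- continuous on the whole line.
  let f : ℝ → ℝ := (Ioi (0 : ℝ)).indicator fun s => h s / s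
  have hfm : Measurable f := (hh.measurable.div measurable_id).indicator measurableSet_Ioi
  have hfi : ∀ a b, IntervalIntegrable f volume a b := by
    intro a b
    have hc : Continuous fun s : ℝ => K * s ^ 2 := by fun_prop
    refine (hc.intervalIntegrable a b).mono_fun' hfm.aestronglyMeasurable
      (Eventually.of_forall fun s => ?_)
    by_cases hs : 0 < s
    · simp only [f]
      rw [indicator_of_mem (show s ∈ Ioi (0 : ℝ) from hs),
        Real.norm_of_nonneg (div_nonneg (hh.nonneg s hs) hs.le)]
      exact hK s hs
    · simp only [f]
      rw [indicator_of_notMem (show s ∉ Ioi (0 : ℝ) from hs), norm_zero]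
      positivity
  have hcont := intervalIntegral.continuous_primitive hfi 1
  have e : cesaro h = fun t : SemiAxis => (1 / Real.log t.1) * ∫ s in (1 : ℝ)..t.1, f s := by
    ext t
    unfold cesaro
    congr 1
    refine intervalIntegral.integral_congr_ae (Eventually.of_forall fun s hs => ?_)
    exact (indicator_of_mem (show s ∈ Ioi (0 : ℝ) from uIoc_pos zero_lt_one t.2 hs) _).symm
  rw [e]
  have h1 : Measurable fun t : SemiAxis => (t : ℝ) := measurable_subtype_coe
  exact (measurable_const.div (Real.measurable_log.comp h1)).mul (hcont.measurable.comp h1)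

/-- For t ≥ e this is the bound on logarithmic means. For t ≤ e the cubic growth bounds the integral
by a multiple of |t - 1|, and |t - 1| ≤ e |log t| absorbs the zero of the logarithm. -/
theorem cesaro_mem_LInfty (hh : HasLogMean h) : cesaro h ∈ LInfty := by
  refine ⟨hh.measurable_cesaro.aemeasurable, ?_⟩
  obtain ⟨K, hK0, hK⟩ := hh.div_le
  obtain ⟨C, hC⟩ := hh.logMean
  have hlow : ∀ t : ℝ, 0 < t → t ≤ Real.exp 1 →
      |∫ s in (1 : ℝ)..t, h s / s| ≤ K * Real.exp 1 ^ 2 * |t - 1| := by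
    intro t ht hte
    rw [← Real.norm_eq_abs]
    refine intervalIntegral.norm_integral_le_of_norm_le_const fun s hs => ?_
    have hs0 := uIoc_pos zero_lt_one ht hs
    have hse : s ≤ Real.exp 1 := hs.2.trans (max_le (Real.one_le_exp zero_le_one) hte)
    rw [Real.norm_of_nonneg (div_nonneg (hh.nonneg s hs0) hs0.le)]
    exact (hK s hs0).trans (by gcongr)
  have hlog : ∀ t : ℝ, 0 < t → t ≤ Real.exp 1 → |t - 1| ≤ Real.exp 1 * |Real.log t| := by
    intro t ht hte
    rcases le_total 1 t with h1 | h1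
    · rw [abs_of_nonneg (by linarith), abs_of_nonneg (Real.log_nonneg h1)]
      have h2 : 1 - t⁻¹ ≤ Real.log t := Real.one_sub_inv_le_log_of_pos ht
      calc t - 1 = t * (1 - t⁻¹) := by field_simp
        _ ≤ Real.exp 1 * Real.log t := by
          have : t⁻¹ ≤ 1 := inv_le_one_of_one_le₀ h1
          gcongr
    · rw [abs_of_nonpos (by linarith), abs_of_nonpos (Real.log_nonpos ht.le h1)]
      have h2 := Real.log_le_sub_one_of_pos ht
      have h3 := Real.one_le_exp zero_le_one
      nlinarith
  refine ⟨max (K * Real.exp 1 ^ 3) C, fun t => ?_⟩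
  unfold cesaro
  rcases le_total t.1 (Real.exp 1) with hte | hte
  · refine le_trans ?_ (le_max_left _ _)
    -- At t = 1 the convention 1 / 0 = 0 makes the value zero.
    by_cases h0 : Real.log t.1 = 0
    · rw [h0]; simp; positivity
    rw [abs_mul, abs_div, abs_one, one_div, inv_mul_le_iff₀ (abs_pos.2 h0)]
    calc _ ≤ K * Real.exp 1 ^ 2 * |t.1 - 1| := hlow t.1 t.2 hte
      _ ≤ K * Real.exp 1 ^ 2 * (Real.exp 1 * |Real.log t.1|) := by
        gcongr
        exact hlog t.1 t.2 hte
      _ = _ := by ring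
  · refine le_trans ?_ (le_max_right _ _)
    have h1 : 1 ≤ Real.log t.1 := by rwa [Real.le_log_iff_exp_le t.2]
    have h2 : 1 ≤ t.1 := (Real.one_le_exp zero_le_one).trans hte
    rw [abs_of_nonneg (mul_nonneg (by positivity) (hh.integral_nonneg h2)), one_div,
      inv_mul_le_iff₀ (by linarith), mul_comm]
    exact hC t.1 hte

end HasLogMean

/-! ### The heat kernel function has bounded logarithmic means. -/

section Heat

variable {N : VonNeumannAlgebra H} {τ : (H →L[ℂ] H) → ℝ≥0∞}

theorem trace_heatOp_lt_top (hτ : IsFaithfulNormalSemifiniteTrace N τ) {q : ℝ} (hq : 0 < q)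
    {A : H →L[ℂ] H} (hA : A ∈ dixmierIdeal N τ) {t : ℝ} (ht : 0 ≤ t) :
    τ (heatOp q (ℜ A : H →L[ℂ] H)⁺ t) < ∞ := by
  obtain ⟨K, -, hK⟩ := exists_trace_heatOp_le hτ hq hA
  exact (hK t ht).trans_lt ENNReal.ofReal_lt_top

theorem hasLogMean_heatFun (hτ : IsFaithfulNormalSemifiniteTrace N τ) {q : ℝ} (hq : 0 < q)
    {A : H →L[ℂ] H} (hA : A ∈ dixmierIdeal N τ) :
    HasLogMean (heatFun τ q (ℜ A : H →L[ℂ] H)⁺) := by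
  have hmono := monotone_trace_heatOp hτ hq (posPart_realPart_mem hA.1)
    (CFC.posPart_nonneg (ℜ A : H →L[ℂ] H))
  have hmeas : Measurable (heatFun τ q (ℜ A : H →L[ℂ] H)⁺) :=
    (measurable_const.div measurable_id).mul hmono.measurable.ennreal_toReal
  have hnn : ∀ t, 0 < t → 0 ≤ heatFun τ q (ℜ A : H →L[ℂ] H)⁺ t := fun t ht =>
    mul_nonneg (by positivity) ENNReal.toReal_nonneg
  refine ⟨hmeas, hnn, ?_, ?_⟩
  · obtain ⟨K, hK0, hK⟩ := exists_trace_heatOp_le hτ hq hA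
    refine ⟨K, hK0, fun t ht => ?_⟩
    unfold heatFun
    rw [one_div, inv_mul_le_iff₀ ht]
    refine (ENNReal.toReal_le_of_le_ofReal (by positivity) (hK t ht.le)).trans_eq ?_
    ring
  · obtain ⟨C, hC0, hC⟩ := exists_lintegral_trace_heatOp_le hτ hq hA
    refine ⟨C, fun T hT => ?_⟩
    have hT1 : 1 ≤ T := (Real.one_le_exp zero_le_one).trans hT
    rw [intervalIntegral.integral_of_le hT1, integral_eq_lintegral_of_nonneg_ae]
    · refine ENNReal.toReal_le_of_le_ofReal (mul_nonneg hC0 (Real.log_nonneg hT1)) ?_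
      refine le_trans (le_of_eq ?_) (hC T hT)
      refine setLIntegral_congr_fun measurableSet_Ioc fun t ht => ?_
      have ht0 : 0 < t := zero_lt_one.trans ht.1
      have hfin := (trace_heatOp_lt_top hτ hq hA ht0.le).ne
      simp only [heatFun]
      conv_rhs => rw [← ENNReal.ofReal_toReal hfin, ← ENNReal.ofReal_mul ENNReal.toReal_nonneg]
      congr 1
      field_simp
    · filter_upwards [ae_restrict_mem measurableSet_Ioc] with t ht
      have ht0 : 0 < t := zero_lt_one.trans ht.1
      exact div_nonneg (hnn t ht0) ht0.le
    · exact (hmeas.div measurable_id).aestronglyMeasurable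

theorem heatFun_smul (τ : (H →L[ℂ] H) → ℝ≥0∞) (q : ℝ) (B : H →L[ℂ] H) {c : ℝ} (hc : 0 < c)
    (t : ℝ) : heatFun τ q (c • B) t = c * heatFun τ q B (c * t) := by
  unfold heatFun heatOp
  rw [smul_smul, mul_comm t c]
  rcases eq_or_ne t 0 with rfl | ht
  · simp
  · field_simp

end Heat

/-! ### Generalised limits -/

theorem const_mem_LInfty (c : ℝ) : (fun _ => c : SemiAxis → ℝ) ∈ LInfty :=
  ⟨aemeasurable_const, |c|, fun _ => le_rfl⟩

theorem dilation_one (z : LInfty) : dilation 1 one_pos z = z := by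
  ext t
  exact congrArg z.1 (Subtype.ext (div_one t.1) : scale 1 one_pos t = t)

theorem dilation_dilation (r s : SemiAxis) (z : LInfty) :
    dilation r.1 r.2 (dilation s.1 s.2 z) = dilation (r.1 * s.1) (mul_pos r.2 s.2) z := by
  ext t
  exact congrArg z.1 (Subtype.ext (div_div t.1 r.1 s.1) :
    scale s.1 s.2 (scale r.1 r.2 t) = scale (r.1 * s.1) (mul_pos r.2 s.2) t)

theorem eventually_le_log (L : ℝ) : ∀ᶠ t : SemiAxis in atTop, L ≤ Real.log t.1 := by
  filter_upwards [eventually_ge_atTop (⟨Real.exp L, Real.exp_pos L⟩ : SemiAxis)] with t ht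
  exact (Real.le_log_iff_exp_le t.2).2 ht

theorem tendsto_scale_atTop (s : ℝ) (hs : 0 < s) : Tendsto (scale s hs) atTop atTop := by
  refine tendsto_atTop.2 fun b => ?_
  filter_upwards [eventually_ge_atTop (⟨s * b.1, mul_pos hs b.2⟩ : SemiAxis)] with t ht
  have h : s * b.1 ≤ t.1 := ht
  change b.1 ≤ t.1 / s
  rw [le_div_iff₀ hs]
  linarith

namespace IsGeneralisedLimit

variable {γ : LInfty →ₗ[ℝ] ℝ}

theorem map_const (hγ : IsGeneralisedLimit γ) (c : ℝ) : γ ⟨fun _ => c, const_mem_LInfty c⟩ = c := by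
  have h1 := hγ.normalised ⟨fun _ => 1, const_mem_LInfty 1⟩ fun _ => rfl
  have e : (⟨fun _ => c, const_mem_LInfty c⟩ : LInfty) = c • ⟨fun _ => 1, const_mem_LInfty 1⟩ := by
    ext t
    change c = c * 1
    rw [mul_one]
  rw [e, map_smul, h1, smul_eq_mul, mul_one]

theorem mono (hγ : IsGeneralisedLimit γ) {z w : LInfty} (h : ∀ t, z.1 t ≤ w.1 t) : γ z ≤ γ w := by
  have := hγ.nonneg (w - z) fun t => sub_nonneg.2 (h t)
  rw [map_sub] at this
  linarith

theorem abs_apply_le (hγ : IsGeneralisedLimit γ) {z : LInfty} {C : ℝ} (h : ∀ t, |z.1 t| ≤ C) :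
    |γ z| ≤ C := by
  rw [abs_le]
  constructor
  · rw [← hγ.map_const (-C)]
    exact hγ.mono fun t => (abs_le.1 (h t)).1
  · rw [← hγ.map_const C]
    exact hγ.mono fun t => (abs_le.1 (h t)).2

theorem congr (hγ : IsGeneralisedLimit γ) {z w : LInfty}
    (h : Tendsto (fun t => z.1 t - w.1 t) atTop (𝓝 0)) : γ z = γ w := by
  have := hγ.vanish (z - w) h
  rw [map_sub] at this
  linarith

/-- The excess of z over w + ε is eventually zero, so it is annihilated by γ and can be added to w +
ε to get a pointwise bound. -/
theorem mono_of_eventually_le_add (hγ : IsGeneralisedLimit γ) {z w : LInfty}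
    (h : ∀ ε : ℝ, 0 < ε → ∀ᶠ t in atTop, z.1 t ≤ w.1 t + ε) : γ z ≤ γ w := by
  refine le_of_forall_pos_le_add fun ε hε => ?_
  obtain ⟨C, hC⟩ := z.2.2
  obtain ⟨D, hD⟩ := w.2.2
  let v : LInfty := ⟨fun t => max (z.1 t - (w.1 t + ε)) 0,
    ⟨(z.2.1.sub (w.2.1.add_const ε)).max aemeasurable_const, C + (D + ε), fun t => by
      rw [abs_of_nonneg (le_max_right _ _)]
      have h1 := abs_le.1 (hC t)
      have h2 := abs_le.1 (hD t)
      have h3 := (abs_nonneg _).trans (hC t)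
      have h4 := (abs_nonneg _).trans (hD t)
      exact max_le (by linarith [h1.2, h2.1]) (by linarith)⟩⟩
  have hv : γ v = 0 := by
    refine hγ.vanish v (tendsto_const_nhds.congr' ?_)
    filter_upwards [h ε hε] with t ht
    exact (max_eq_right (by linarith)).symm
  have h1 : γ z ≤ γ (w + ⟨fun _ => ε, const_mem_LInfty ε⟩ + v) := by
    refine hγ.mono fun t => ?_
    change z.1 t ≤ w.1 t + ε + max (z.1 t - (w.1 t + ε)) 0
    linarith [le_max_left (z.1 t - (w.1 t + ε)) 0]
  rw [map_add, map_add, hγ.map_const, hv] at h1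
  linarith

theorem comp_dilation (hγ : IsGeneralisedLimit γ) (s : ℝ) (hs : 0 < s) :
    IsGeneralisedLimit (γ ∘ₗ dilation s hs) where
  nonneg _ hz := hγ.nonneg _ fun _ => hz _
  normalised _ hz := hγ.normalised _ fun _ => hz _
  vanish _ hz := hγ.vanish _ (hz.comp (tendsto_scale_atTop s hs))

end IsGeneralisedLimit

/-- Pointwise limits of generalised limits along an ultrafilter. -/
theorem exists_ultrafilter_limit {ι : Type*} (U : Ultrafilter ι) (φ : ι → LInfty →ₗ[ℝ] ℝ)
    (hφ : ∀ i, IsGeneralisedLimit (φ i)) :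
    ∃ ψ : LInfty →ₗ[ℝ] ℝ, IsGeneralisedLimit ψ ∧
      ∀ z, Tendsto (fun i => φ i z) U (𝓝 (ψ z)) := by
  have hex : ∀ z : LInfty, ∃ l : ℝ, Tendsto (fun i => φ i z) U (𝓝 l) := by
    intro z
    obtain ⟨C, hC⟩ := z.2.2
    have hmem : ∀ i, φ i z ∈ Icc (-C) C := fun i => abs_le.1 ((hφ i).abs_apply_le hC)
    obtain ⟨l, -, hl⟩ := (isCompact_Icc (a := -C) (b := C)).ultrafilter_le_nhds
      (U.map fun i => φ i z) (by
        rw [le_principal_iff]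
        exact Ultrafilter.mem_map.2 (univ_mem' hmem))
    exact ⟨l, hl⟩
  choose ψ hψ using hex
  refine ⟨⟨⟨ψ, fun z w => ?_⟩, fun c z => ?_⟩, ⟨fun z hz => ?_, fun z hz => ?_, fun z hz => ?_⟩, hψ⟩
  · refine tendsto_nhds_unique (hψ (z + w)) ?_
    simp only [map_add]
    exact (hψ z).add (hψ w)
  · refine tendsto_nhds_unique (hψ (c • z)) ?_
    simp only [map_smul]
    exact (hψ z).const_smul c
  · exact ge_of_tendsto' (hψ z) fun i => (hφ i).nonneg z hz
  · refine tendsto_nhds_unique (hψ z) ?_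
    simp only [fun i => (hφ i).normalised z hz]
    exact tendsto_const_nhds
  · refine tendsto_nhds_unique (hψ z) ?_
    simp only [fun i => (hφ i).vanish z hz]
    exact tendsto_const_nhds

theorem IsGeneralisedLimit.average {φ : ℕ → LInfty →ₗ[ℝ] ℝ} (hφ : ∀ i, IsGeneralisedLimit (φ i))
    (n : ℕ) : IsGeneralisedLimit (((n : ℝ) + 1)⁻¹ • ∑ i ∈ Finset.range (n + 1), φ i) where
  nonneg z hz := by
    rw [LinearMap.smul_apply, LinearMap.sum_apply, smul_eq_mul]
    exact mul_nonneg (by positivity) (Finset.sum_nonneg fun i _ => (hφ i).nonneg z hz)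
  normalised z hz := by
    rw [LinearMap.smul_apply, LinearMap.sum_apply, smul_eq_mul,
      Finset.sum_congr rfl fun i _ => (hφ i).normalised z hz]
    simp
    field_simp
  vanish z hz := by
    rw [LinearMap.smul_apply, LinearMap.sum_apply, smul_eq_mul,
      Finset.sum_congr rfl fun i _ => (hφ i).vanish z hz]
    simp

/-- Averaging a generalised limit over the powers of one dilation. -/
theorem exists_invariant_under (γ : LInfty →ₗ[ℝ] ℝ) (hγ : IsGeneralisedLimit γ) (s : SemiAxis) :
    ∃ ψ : LInfty →ₗ[ℝ] ℝ, IsGeneralisedLimit ψ ∧ (∀ z, ψ (dilation s.1 s.2 z) = ψ z) ∧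
      (∀ r : SemiAxis, (∀ z, γ (dilation r.1 r.2 z) = γ z) → ∀ z, ψ (dilation r.1 r.2 z) = ψ z) ∧
      ∀ (z : LInfty) (c : ℝ), (∀ r : SemiAxis, γ (dilation r.1 r.2 z) = c) →
        ∀ r : SemiAxis, ψ (dilation r.1 r.2 z) = c := by
  let p : ℕ → SemiAxis := fun i => ⟨s.1 ^ i, pow_pos s.2 i⟩
  let φ : ℕ → LInfty →ₗ[ℝ] ℝ := fun i => γ ∘ₗ dilation (p i).1 (p i).2
  have hφ : ∀ i, IsGeneralisedLimit (φ i) := fun i => hγ.comp_dilation _ _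
  let A : ℕ → LInfty →ₗ[ℝ] ℝ := fun n => ((n : ℝ) + 1)⁻¹ • ∑ i ∈ Finset.range (n + 1), φ i
  have hA : ∀ n z, A n z = ((n : ℝ) + 1)⁻¹ * ∑ i ∈ Finset.range (n + 1), φ i z := fun n z => by
    simp only [A]
    rw [LinearMap.smul_apply, LinearMap.sum_apply, smul_eq_mul]
  have hφd : ∀ i (r : SemiAxis) z,
      φ i (dilation r.1 r.2 z) = γ (dilation ((p i).1 * r.1) (mul_pos (p i).2 r.2) z) :=
    fun i r z => congrArg γ (dilation_dilation (p i) r z)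
  obtain ⟨ψ, hψ, hlim⟩ := exists_ultrafilter_limit (hyperfilter ℕ) A
    (IsGeneralisedLimit.average hφ)
  have hU : (hyperfilter ℕ : Filter ℕ) ≤ atTop := Nat.hyperfilter_le_atTop
  refine ⟨ψ, hψ, fun z => ?_, fun r hr z => ?_, fun z c hz r => ?_⟩
  · obtain ⟨C, hC⟩ := z.2.2
    have h1 : Tendsto (fun n => A n (dilation s.1 s.2 z) - A n z) (hyperfilter ℕ : Filter ℕ)
        (𝓝 (ψ (dilation s.1 s.2 z) - ψ z)) := (hlim _).sub (hlim z)
    -- Dilating by s shifts the index by one, so the difference of averages telescopes to two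
    -- boundary terms.
    have h2 : ∀ n, ‖A n (dilation s.1 s.2 z) - A n z‖ ≤ (2 * C) * ((n : ℝ) + 1)⁻¹ := by
      intro n
      have e : ∀ i, φ i (dilation s.1 s.2 z) = φ (i + 1) z := fun i => by
        rw [hφd]
        simp only [φ, p, LinearMap.comp_apply, pow_succ]
      rw [hA, hA, ← mul_sub, ← Finset.sum_sub_distrib]
      simp only [e]
      rw [Finset.sum_range_sub (fun i => φ i z), norm_mul, Real.norm_of_nonneg (by positivity),
        mul_comm]
      gcongr
      refine (norm_sub_le _ _).trans ?_
      have := (hφ (n + 1)).abs_apply_le hC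
      have := (hφ 0).abs_apply_le hC
      simp only [Real.norm_eq_abs]
      linarith
    have h3 : Tendsto (fun n : ℕ => (2 * C) * ((n : ℝ) + 1)⁻¹) atTop (𝓝 0) := by
      have := (tendsto_one_div_add_atTop_nhds_zero_nat (𝕜 := ℝ)).const_mul (2 * C)
      simpa using this
    have h4 := tendsto_nhds_unique h1 (squeeze_zero_norm h2 (h3.mono_left hU))
    linarith
  -- Dilations commute, so each average inherits the invariances of γ.
  · have e : ∀ n, A n (dilation r.1 r.2 z) = A n z := fun n => by
      rw [hA, hA]
      congr 1
      refine Finset.sum_congr rfl fun i _ => ?_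
      have h1 := hr (dilation (p i).1 (p i).2 z)
      rw [dilation_dilation] at h1
      rw [hφd]
      simp only [mul_comm _ r.1]
      exact h1
    have h1 := hlim (dilation r.1 r.2 z)
    simp only [e] at h1
    exact tendsto_nhds_unique h1 (hlim z)
  · have e : ∀ n, A n (dilation r.1 r.2 z) = c := fun n => by
      rw [hA, Finset.sum_congr rfl fun i _ =>
        (hφd i r z).trans (hz ⟨(p i).1 * r.1, mul_pos (p i).2 r.2⟩)]
      simp
      field_simp
    have h1 := hlim (dilation r.1 r.2 z)
    simp only [e] at h1
    exact tendsto_nhds_unique h1 tendsto_const_nhds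

/-- Every generalised limit can be averaged to a dilation invariant one without changing its values
at the elements on whose dilation orbits it is constant. -/
theorem exists_dilationInvariant (γ : LInfty →ₗ[ℝ] ℝ) (hγ : IsGeneralisedLimit γ) :
    ∃ ψ : LInfty →ₗ[ℝ] ℝ, IsGeneralisedLimit ψ ∧ IsDilationInvariant ψ ∧
      ∀ z : LInfty, (∀ r : SemiAxis, γ (dilation r.1 r.2 z) = γ z) → ψ z = γ z := by
  classical
  have key : ∀ F : Finset SemiAxis, ∃ ψ : LInfty →ₗ[ℝ] ℝ, IsGeneralisedLimit ψ ∧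
      (∀ s ∈ F, ∀ z, ψ (dilation s.1 s.2 z) = ψ z) ∧
      ∀ (z : LInfty) (c : ℝ), (∀ r : SemiAxis, γ (dilation r.1 r.2 z) = c) →
        ∀ r : SemiAxis, ψ (dilation r.1 r.2 z) = c := by
    intro F
    induction F using Finset.induction_on with
    | empty => exact ⟨γ, hγ, by simp, fun z c h => h⟩
    | insert s F hs ih =>
      obtain ⟨φ, hφ, hF, hc⟩ := ih
      obtain ⟨ψ, hψ, h1, h2, h3⟩ := exists_invariant_under φ hφ s
      refine ⟨ψ, hψ, fun r hr => ?_, fun z c hz => h3 z c (hc z c hz)⟩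
      rcases Finset.mem_insert.1 hr with rfl | hr
      · exact h1
      · exact h2 r (hF r hr)
  choose φ hφ hF hc using key
  -- Along an ultrafilter finer than `atTop` on finite sets, each dilation eventually belongs to F,
  -- so the limit is invariant under all of them.
  obtain ⟨ψ, hψ, hlim⟩ := exists_ultrafilter_limit (Ultrafilter.of (atTop : Filter (Finset SemiAxis)))
    φ hφ
  have hU := Ultrafilter.of_le (atTop : Filter (Finset SemiAxis))
  refine ⟨ψ, hψ, fun s hs z => ?_, fun z hz => ?_⟩
  · refine tendsto_nhds_unique (hlim _) ((hlim z).congr' ?_)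
    filter_upwards [hU (eventually_ge_atTop ({⟨s, hs⟩} : Finset SemiAxis))] with F hsF
    exact (hF F ⟨s, hs⟩ (hsF (Finset.mem_singleton_self _)) z).symm
  · refine tendsto_nhds_unique (hlim z) (tendsto_const_nhds.congr fun F => ?_)
    have := hc F z (γ z) hz ⟨1, one_pos⟩
    rw [dilation_one] at this
    exact this.symm

/-! ### Smoothing by logarithmic translations -/

theorem measurable_scale_exp :
    Measurable fun p : SemiAxis × ℝ => scale (Real.exp p.2) (Real.exp_pos p.2) p.1 :=
  Measurable.subtype_mk ((measurable_subtype_coe.comp measurable_fst).div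
    (Real.measurable_exp.comp measurable_snd))

/-- The preimage of a null set is contained in its image under the differentiable map u ↦ log t -
log u, which preserves null sets. Hence smoothing sees only the almost everywhere class of z, at
every single t. -/
theorem quasiMeasurePreserving_scale_exp (t : SemiAxis) :
    Measure.QuasiMeasurePreserving (fun v : ℝ => scale (Real.exp v) (Real.exp_pos v) t) volume
      lebesgue := by
  have hm : Measurable fun v : ℝ => scale (Real.exp v) (Real.exp_pos v) t :=
    measurable_scale_exp.comp (measurable_const.prodMk measurable_id)
  refine ⟨hm, Measure.AbsolutelyContinuous.mk fun A hA h0 => ?_⟩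
  rw [Measure.map_apply hm hA]
  have h1 : volume (Subtype.val '' A : Set ℝ) = 0 := by
    rw [← h0]
    exact (comap_subtype_coe_apply measurableSet_Ioi volume A).symm
  have h2 : volume ((fun u : ℝ => Real.log t.1 - Real.log u) '' (Subtype.val '' A)) = 0 := by
    refine addHaar_image_eq_zero_of_differentiableOn_of_addHaar_eq_zero volume ?_ h1
    rintro _ ⟨u, -, rfl⟩
    exact ((differentiableAt_const _).sub
      (Real.differentiableAt_log u.2.ne')).differentiableWithinAt
  refine measure_mono_null (fun v hv => ?_) h2
  refine ⟨_, ⟨_, hv, rfl⟩, ?_⟩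
  change Real.log t.1 - Real.log (t.1 / Real.exp v) = v
  rw [Real.log_div t.2.ne' (Real.exp_pos v).ne', Real.log_exp]
  ring

theorem intervalIntegrable_scale_exp (z : LInfty) (t : SemiAxis) (a b : ℝ) :
    IntervalIntegrable (fun v => z.1 (scale (Real.exp v) (Real.exp_pos v) t)) volume a b := by
  obtain ⟨C, hC⟩ := z.2.2
  have hm := z.2.1.comp_quasiMeasurePreserving (quasiMeasurePreserving_scale_exp t)
  exact (intervalIntegrable_const (c := C)).mono_fun' hm.aestronglyMeasurable.restrict
    (Eventually.of_forall fun v => hC _)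

/-- The function `t ↦ ∫_0^1 z(t e^{-v}) dv`. -/
def smoothFun (z : SemiAxis → ℝ) (t : SemiAxis) : ℝ :=
  ∫ v in (0 : ℝ)..1, z (scale (Real.exp v) (Real.exp_pos v) t)

theorem smoothFun_congr {z w : SemiAxis → ℝ} (h : z =ᵐ[lebesgue] w) : smoothFun z = smoothFun w := by
  ext t
  refine intervalIntegral.integral_congr_ae ?_
  filter_upwards [(quasiMeasurePreserving_scale_exp t).ae_eq_comp h] with v hv _ using hv

theorem abs_smoothFun_le {z : SemiAxis → ℝ} {t : SemiAxis} {C : ℝ}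
    (h : ∀ v ∈ Icc (0 : ℝ) 1, |z (scale (Real.exp v) (Real.exp_pos v) t)| ≤ C) :
    |smoothFun z t| ≤ C := by
  have := intervalIntegral.norm_integral_le_of_norm_le_const (a := 0) (b := 1)
    (f := fun v => z (scale (Real.exp v) (Real.exp_pos v) t)) (C := C) fun v hv => by
      rw [uIoc_of_le zero_le_one] at hv
      exact h v ⟨hv.1.le, hv.2⟩
  simpa [smoothFun] using this

theorem smoothFun_mem (z : LInfty) : smoothFun z.1 ∈ LInfty := by
  constructor
  · rw [smoothFun_congr z.2.1.ae_eq_mk]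
    refine Measurable.aemeasurable (StronglyMeasurable.measurable ?_)
    have h1 : StronglyMeasurable fun p : SemiAxis × ℝ =>
        z.2.1.mk z.1 (scale (Real.exp p.2) (Real.exp_pos p.2) p.1) :=
      (z.2.1.measurable_mk.comp measurable_scale_exp).stronglyMeasurable
    have h2 := h1.integral_prod_right' (ν := volume.restrict (Ioc (0 : ℝ) 1))
    have e : smoothFun (z.2.1.mk z.1) = fun t => ∫ v in Ioc (0 : ℝ) 1,
        z.2.1.mk z.1 (scale (Real.exp v) (Real.exp_pos v) t) := by
      ext t
      exact intervalIntegral.integral_of_le zero_le_one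
    rw [e]
    exact h2
  · obtain ⟨C, hC⟩ := z.2.2
    exact ⟨C, fun t => abs_smoothFun_le fun v _ => hC _⟩

/-- The smoothing operator `z ↦ (t ↦ ∫_0^1 z(t e^{-v}) dv)` on `L_∞(0, ∞)`. -/
def smooth : LInfty →ₗ[ℝ] LInfty where
  toFun z := ⟨smoothFun z.1, smoothFun_mem z⟩
  map_add' z w := by
    ext t
    exact intervalIntegral.integral_add (intervalIntegrable_scale_exp z t 0 1)
      (intervalIntegrable_scale_exp w t 0 1)
  map_smul' c z := by
    ext t
    exact intervalIntegral.integral_const_mul c _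

theorem smooth_dilation (s : ℝ) (hs : 0 < s) (z : LInfty) :
    smooth (dilation s hs z) = dilation s hs (smooth z) := by
  ext t
  refine intervalIntegral.integral_congr fun v _ => congrArg z.1 (Subtype.ext ?_)
  exact div_right_comm _ _ _

theorem IsGeneralisedLimit.comp_smooth {γ : LInfty →ₗ[ℝ] ℝ} (hγ : IsGeneralisedLimit γ) :
    IsGeneralisedLimit (γ ∘ₗ smooth) where
  nonneg z hz := hγ.nonneg _ fun t =>
    intervalIntegral.integral_nonneg zero_le_one fun v _ => hz _
  normalised z hz := hγ.normalised _ fun t => by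
    change smoothFun z.1 t = 1
    unfold smoothFun
    simp [hz]
  vanish z hz := hγ.vanish _ <| by
    rw [Metric.tendsto_nhds] at hz ⊢
    intro ε hε
    obtain ⟨a, ha⟩ := eventually_atTop.1 (hz (ε / 2) (by positivity))
    filter_upwards [eventually_ge_atTop
      (⟨a.1 * Real.exp 1, mul_pos a.2 (Real.exp_pos 1)⟩ : SemiAxis)] with t ht
    have ht' : a.1 * Real.exp 1 ≤ t.1 := ht
    have h1 : |smoothFun z.1 t| ≤ ε / 2 := by
      refine abs_smoothFun_le fun v hv => ?_
      have h2 := ha (scale (Real.exp v) (Real.exp_pos v) t) (by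
        change a.1 ≤ t.1 / Real.exp v
        rw [le_div_iff₀ (Real.exp_pos v)]
        have : Real.exp v ≤ Real.exp 1 := Real.exp_le_exp.2 hv.2
        have ha0 : 0 < a.1 := a.2
        nlinarith)
      rw [Real.dist_eq, sub_zero] at h2
      exact h2.le
    rw [Real.dist_eq, sub_zero]
    change |smoothFun z.1 t| < ε
    linarith

theorem IsDilationInvariant.comp_smooth {γ : LInfty →ₗ[ℝ] ℝ} (hγ : IsDilationInvariant γ) :
    IsDilationInvariant (γ ∘ₗ smooth) := fun s hs z => by
  rw [LinearMap.comp_apply, smooth_dilation, hγ s hs]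
  rfl

theorem respectsAE_comp_smooth (γ : LInfty →ₗ[ℝ] ℝ) : RespectsAE (γ ∘ₗ smooth) := fun _ _ h =>
  congrArg γ (Subtype.ext (smoothFun_congr h))

/-- Smoothing does not change the value of a dilation invariant generalised limit at logarithmic
means. -/
theorem apply_smooth_cesaro {γ : LInfty →ₗ[ℝ] ℝ} (hγ : IsGeneralisedLimit γ)
    (hinv : IsDilationInvariant γ) {h : ℝ → ℝ} (hh : HasLogMean h) :
    γ (smooth ⟨cesaro h, hh.cesaro_mem_LInfty⟩) = γ ⟨cesaro h, hh.cesaro_mem_LInfty⟩ := by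
  set x : LInfty := ⟨cesaro h, hh.cesaro_mem_LInfty⟩ with hx
  obtain ⟨C, hC⟩ := x.2.2
  let G : ℝ → ℝ := fun t => ∫ s in (1 : ℝ)..t, h s / s
  have hxG : ∀ t : SemiAxis, Real.log t.1 ≠ 0 → G t.1 = x.1 t * Real.log t.1 := fun t ht => by
    change G t.1 = 1 / Real.log t.1 * G t.1 * Real.log t.1
    field_simp
  have hval : ∀ (t : SemiAxis) (v : ℝ),
      x.1 (scale (Real.exp v) (Real.exp_pos v) t) =
        1 / (Real.log t.1 - v) * G (t.1 / Real.exp v) := fun t v => by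
    change 1 / Real.log (t.1 / Real.exp v) * G (t.1 / Real.exp v) = _
    rw [Real.log_div t.2.ne' (Real.exp_pos v).ne', Real.log_exp]
  have hexp : ∀ L : ℝ, ∀ t : SemiAxis, L ≤ Real.log t.1 → Real.exp L ≤ t.1 := fun L t ht =>
    (Real.le_log_iff_exp_le t.2).1 ht
  -- As G(t) = x(t) log t increases for t ≥ 1, the average of x over [t/e, t] lies between x(t/e) -
  -- ε and x(t) + ε for large t. The lower bound is matched with γ(x) through invariance under
  -- dilation by e.
  refine le_antisymm (hγ.mono_of_eventually_le_add fun ε hε => ?_) ?_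
  · filter_upwards [eventually_le_log (2 + C / ε)] with t ht
    have hC0 : 0 ≤ C := (abs_nonneg _).trans (hC t)
    have hdiv : 0 ≤ C / ε := by positivity
    have hl : 0 < Real.log t.1 - 1 := by linarith
    have hb : ∀ v ∈ Icc (0 : ℝ) 1, x.1 (scale (Real.exp v) (Real.exp_pos v) t) ≤ x.1 t + ε := by
      intro v hv
      have h1 : 1 ≤ t.1 / Real.exp v := by
        rw [le_div_iff₀ (Real.exp_pos v), one_mul]
        exact hexp v t (by linarith [hv.2])
      have h2 : G (t.1 / Real.exp v) ≤ G t.1 :=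
        hh.integral_mono_right (zero_lt_one.trans_le h1)
          (div_le_self t.2.le (Real.one_le_exp hv.1))
      have h3 : 0 ≤ G t.1 := (hh.integral_nonneg h1).trans h2
      rw [hval]
      calc 1 / (Real.log t.1 - v) * G (t.1 / Real.exp v)
          ≤ 1 / (Real.log t.1 - 1) * G t.1 := by
            apply mul_le_mul _ h2 (hh.integral_nonneg h1) (by positivity)
            exact one_div_le_one_div_of_le hl (by linarith [hv.2])
        _ = x.1 t + x.1 t / (Real.log t.1 - 1) := by
            rw [hxG t (by linarith)]
            field_simp
            ring
        _ ≤ x.1 t + ε := by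
            gcongr
            rw [div_le_iff₀ hl]
            have h4 : C ≤ ε * (Real.log t.1 - 1) := by
              have : C = ε * (C / ε) := by field_simp
              rw [this]
              gcongr
              linarith
            exact ((le_abs_self _).trans (hC t)).trans h4
    have := intervalIntegral.integral_mono_on zero_le_one (intervalIntegrable_scale_exp x t 0 1)
      (intervalIntegrable_const (c := x.1 t + ε)) hb
    change smoothFun x.1 t ≤ x.1 t + ε
    simpa [smoothFun] using this
  · rw [← hinv (Real.exp 1) (Real.exp_pos 1) x]
    refine hγ.mono_of_eventually_le_add fun ε hε => ?_
    filter_upwards [eventually_le_log (2 + C / ε)] with t ht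
    have hC0 : 0 ≤ C := (abs_nonneg _).trans (hC t)
    have hdiv : 0 ≤ C / ε := by positivity
    have hl : 0 < Real.log t.1 - 1 := by linarith
    set y := x.1 (scale (Real.exp 1) (Real.exp_pos 1) t) with hy
    have hyC : |y| ≤ C := hC _
    have hyG : G (t.1 / Real.exp 1) = y * (Real.log t.1 - 1) := by
      rw [hy, hval]; field_simp
    have hb : ∀ v ∈ Icc (0 : ℝ) 1, y - ε ≤ x.1 (scale (Real.exp v) (Real.exp_pos v) t) := by
      intro v hv
      have h1 : 1 ≤ t.1 / Real.exp 1 := by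
        rw [le_div_iff₀ (Real.exp_pos 1), one_mul]
        exact hexp 1 t (by linarith)
      have h2 : G (t.1 / Real.exp 1) ≤ G (t.1 / Real.exp v) :=
        hh.integral_mono_right (zero_lt_one.trans_le h1)
          (div_le_div_of_nonneg_left t.2.le (Real.exp_pos v) (Real.exp_le_exp.2 hv.2))
      have h3 : 0 ≤ G (t.1 / Real.exp 1) := hh.integral_nonneg h1
      rw [hval]
      calc y - ε ≤ y - y / Real.log t.1 := by
            gcongr
            rw [div_le_iff₀ (by linarith)]
            have h4 : C ≤ ε * Real.log t.1 := by
              have : C = ε * (C / ε) := by field_simp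
              rw [this]
              gcongr
              linarith
            exact ((le_abs_self _).trans hyC).trans h4
        _ = 1 / Real.log t.1 * G (t.1 / Real.exp 1) := by
            have : Real.log t.1 ≠ 0 := by linarith
            rw [hyG]
            field_simp
        _ ≤ 1 / (Real.log t.1 - v) * G (t.1 / Real.exp v) := by
            apply mul_le_mul _ h2 h3 _
            · exact one_div_le_one_div_of_le (by linarith [hv.2]) (by linarith [hv.1])
            · have : 0 < Real.log t.1 - v := by linarith [hv.2]
              positivity
    have := intervalIntegral.integral_mono_on zero_le_one (intervalIntegrable_const (c := y - ε))
      (intervalIntegrable_scale_exp x t 0 1) hb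
    have h5 : y - ε ≤ smoothFun x.1 t := by simpa [smoothFun] using this
    change y ≤ smoothFun x.1 t + ε
    linarith

/-! ### Dilations of logarithmic means -/

/-- Up to a function vanishing at infinity, logarithmic means commute with dilations. -/
theorem apply_cesaro_comp_mul {γ : LInfty →ₗ[ℝ] ℝ} (hγ : IsGeneralisedLimit γ) {h g : ℝ → ℝ}
    (hh : HasLogMean h) (hg : HasLogMean g) {c : ℝ} (hc : 0 < c) (hgh : ∀ t, g t = c * h (c * t)) :
    γ ⟨cesaro g, hg.cesaro_mem_LInfty⟩ =
      c * γ (dilation c⁻¹ (inv_pos.2 hc) ⟨cesaro h, hh.cesaro_mem_LInfty⟩) := by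
  set x : LInfty := ⟨cesaro h, hh.cesaro_mem_LInfty⟩ with hx
  obtain ⟨C, hC⟩ := x.2.2
  let G : ℝ → ℝ := fun t => ∫ s in (1 : ℝ)..t, h s / s
  -- Substituting u = c s moves the lower limit to c, at the cost of the constant G c.
  have hint : ∀ t : ℝ, 0 < t → ∫ s in (1 : ℝ)..t, g s / s = c * (G (c * t) - G c) := by
    intro t ht
    have e : (fun s => g s / s) = fun s => c * (c * (h (c * s) / (c * s))) := by
      ext s
      rw [hgh]
      rcases eq_or_ne s 0 with rfl | hs
      · simp
      · field_simp
    rw [e, intervalIntegral.integral_const_mul, intervalIntegral.integral_const_mul,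
      intervalIntegral.mul_integral_comp_mul_left (f := fun s => h s / s), mul_one]
    congr 1
    rw [eq_sub_iff_add_eq, add_comm]
    exact intervalIntegral.integral_add_adjacent_intervals
      (hh.intervalIntegrable zero_lt_one hc) (hh.intervalIntegrable hc (by positivity))
  rw [← smul_eq_mul, ← map_smul]
  -- The discrepancies are the constant G c and log(ct) - log t = log c; divided by log t, both
  -- vanish at infinity.
  refine hγ.congr ?_
  have hlog : Tendsto (fun t : SemiAxis => Real.log t.1) atTop atTop :=
    tendsto_atTop.2 eventually_le_log
  have hlim : Tendsto (fun t : SemiAxis => c * (C * |Real.log c| + |G c|) / Real.log t.1) atTop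
      (𝓝 0) := hlog.const_div_atTop _
  refine squeeze_zero_norm' ?_ hlim
  filter_upwards [eventually_le_log (1 + |Real.log c|)] with t ht
  have hl : 0 < Real.log t.1 := by linarith [abs_nonneg (Real.log c)]
  have hlc : 0 < Real.log (c * t.1) := by
    rw [Real.log_mul hc.ne' t.2.ne']
    linarith [neg_abs_le (Real.log c)]
  set y := x.1 (scale c⁻¹ (inv_pos.2 hc) t) with hy
  have hyC : |y| ≤ C := hC _
  have hyG : y = 1 / Real.log (c * t.1) * G (c * t.1) := by
    change 1 / Real.log (t.1 / c⁻¹) * G (t.1 / c⁻¹) = _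
    rw [div_inv_eq_mul, mul_comm t.1 c]
  have e : (1 / Real.log t.1) * (c * (G (c * t.1) - G c)) - c * y =
      c * (y * Real.log c - G c) / Real.log t.1 := by
    have h1 : G (c * t.1) = y * (Real.log c + Real.log t.1) := by
      rw [hyG, ← Real.log_mul hc.ne' t.2.ne']; field_simp
    rw [h1]
    field_simp
    ring
  change ‖(1 / Real.log t.1) * (∫ s in (1 : ℝ)..t.1, g s / s) - c * y‖ ≤ _
  rw [hint t.1 t.2, e, norm_div, norm_mul, Real.norm_of_nonneg hc.le, Real.norm_of_nonneg hl.le]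
  gcongr
  refine (norm_sub_le _ _).trans ?_
  rw [norm_mul]
  simp only [Real.norm_eq_abs]
  gcongr

/-! ### The functionals `ξ_γ` -/

section Xi

variable {N : VonNeumannAlgebra H} {τ : (H →L[ℂ] H) → ℝ≥0∞}

/-- The negative part for A is the positive part for -A, and the ideal is stable under scalars. -/
theorem hasLogMean_heatFun_negPart (hτ : IsFaithfulNormalSemifiniteTrace N τ) {q : ℝ} (hq : 0 < q)
    {A : H →L[ℂ] H} (hA : A ∈ dixmierIdeal N τ) :
    HasLogMean (heatFun τ q (ℜ A : H →L[ℂ] H)⁻) := by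
  have h := hasLogMean_heatFun hτ hq (smul_mem_dixmierIdeal hA (-1))
  have e : (ℜ ((-1 : ℂ) • A) : H →L[ℂ] H) = -(ℜ A : H →L[ℂ] H) := by
    rw [neg_smul, one_smul, _root_.map_neg]
    rfl
  rwa [e, CFC.posPart_neg] at h

theorem xiPos_eq (q : ℝ) (γ : LInfty →ₗ[ℝ] ℝ) {B : H →L[ℂ] H} (h : HasLogMean (heatFun τ q B)) :
    xiPos τ q γ B = γ ⟨cesaro (heatFun τ q B), h.cesaro_mem_LInfty⟩ :=
  dif_pos h.cesaro_mem_LInfty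

theorem xi_re (q : ℝ) (γ : LInfty →ₗ[ℝ] ℝ) (A : H →L[ℂ] H) :
    (xi τ q γ A).re = xiPos τ q γ (ℜ A : H →L[ℂ] H)⁺ - xiPos τ q γ (ℜ A : H →L[ℂ] H)⁻ := by
  simp [xi]

theorem coe_realPart_real_smul (c : ℝ) (A : H →L[ℂ] H) :
    (ℜ ((c : ℂ) • A) : H →L[ℂ] H) = c • (ℜ A : H →L[ℂ] H) := by
  rw [realPart_apply_coe, realPart_apply_coe, star_smul, Complex.star_def, Complex.conj_ofReal,
    ← smul_add, Complex.coe_smul, smul_comm]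

/-- If `ξ_γ` is linear, then `γ` is constant on the dilation orbit of the difference of the
logarithmic means defining the real part of `ξ_γ(A)`. -/
theorem apply_dilation_sub (hτ : IsFaithfulNormalSemifiniteTrace N τ) {q : ℝ} (hq : 0 < q)
    {γ : LInfty →ₗ[ℝ] ℝ} (hγ : IsGeneralisedLimit γ)
    (hlin : IsLinearFunctionalOn (dixmierIdeal N τ) (xi τ q γ)) {A : H →L[ℂ] H}
    (hA : A ∈ dixmierIdeal N τ) (r : SemiAxis) :
    γ (dilation r.1 r.2 (⟨_, (hasLogMean_heatFun hτ hq hA).cesaro_mem_LInfty⟩ -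
        ⟨_, (hasLogMean_heatFun_negPart hτ hq hA).cesaro_mem_LInfty⟩)) =
      γ (⟨_, (hasLogMean_heatFun hτ hq hA).cesaro_mem_LInfty⟩ -
        ⟨_, (hasLogMean_heatFun_negPart hτ hq hA).cesaro_mem_LInfty⟩) := by
  -- Scaling A by c dilates the logarithmic means by c⁻¹ = r. The factor c then cancels against
  -- homogeneity of ξ_γ.
  set c := r.1⁻¹ with hc
  have hc0 : 0 < c := inv_pos.2 r.2
  have hcA := smul_mem_dixmierIdeal hA (c : ℂ)
  have hp := hasLogMean_heatFun hτ hq hA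
  have hn := hasLogMean_heatFun_negPart hτ hq hA
  have hcp := hasLogMean_heatFun hτ hq hcA
  have hcn := hasLogMean_heatFun_negPart hτ hq hcA
  have h1 := congrArg Complex.re (hlin.map_smul (c : ℂ) A hA)
  rw [Complex.re_ofReal_mul, xi_re, xi_re, xiPos_eq q γ hp, xiPos_eq q γ hn, xiPos_eq q γ hcp,
    xiPos_eq q γ hcn,
    apply_cesaro_comp_mul hγ hp hcp hc0 (fun t => by
      rw [coe_realPart_real_smul, CFC.posPart_smul_of_nonneg hc0.le, heatFun_smul τ q _ hc0]),
    apply_cesaro_comp_mul hγ hn hcn hc0 (fun t => by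
      rw [coe_realPart_real_smul, CFC.negPart_smul_of_nonneg hc0.le, heatFun_smul τ q _ hc0]),
    ← mul_sub] at h1
  have h2 := mul_left_cancel₀ hc0.ne' h1
  simp only [hc, inv_inv] at h2
  rw [map_sub, map_sub, map_sub]
  exact h2

end Xi

end HeatKernel

end

/-! ### Well-definedness and the dilation invariant representative. -/

theorem mainTheorem7 {H : Type*} [NormedAddCommGroup H] [InnerProductSpace ℂ H] [CompleteSpace H]
    (N : VonNeumannAlgebra H) (τ : (H →L[ℂ] H) → ℝ≥0∞)
    (hτ : HeatKernel.IsFaithfulNormalSemifiniteTrace N τ) (q : ℝ) (hq : 0 < q) :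
    (∀ A ∈ HeatKernel.dixmierIdeal N τ, 0 ≤ A →
      (∀ t : ℝ, 0 < t → τ (HeatKernel.heatOp q A t) < ∞) ∧
        HeatKernel.cesaro (HeatKernel.heatFun τ q A) ∈ HeatKernel.LInfty) ∧
    ∀ γ : HeatKernel.LInfty →ₗ[ℝ] ℝ, HeatKernel.IsGeneralisedLimit γ →
      HeatKernel.IsLinearFunctionalOn (HeatKernel.dixmierIdeal N τ) (HeatKernel.xi τ q γ) →
      ∃ ω : HeatKernel.LInfty →ₗ[ℝ] ℝ, HeatKernel.IsGeneralisedLimit ω ∧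
        HeatKernel.IsDilationInvariant ω ∧ HeatKernel.RespectsAE ω ∧
        ∀ A ∈ HeatKernel.dixmierIdeal N τ, HeatKernel.xi τ q γ A = HeatKernel.xi τ q ω A := by
  refine ⟨fun A hA hA0 => ?_, fun γ hγ hlin => ?_⟩
  -- The estimates are stated for (ℜ A)⁺; a positive A is its own such part.
  · have e : (ℜ A : H →L[ℂ] H)⁺ = A := by
      rw [(IsSelfAdjoint.of_nonneg hA0).coe_realPart, CFC.posPart_eq_self]
      exact hA0
    have h1 := fun t (ht : 0 < t) => HeatKernel.trace_heatOp_lt_top hτ hq hA ht.le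
    have h2 := (HeatKernel.hasLogMean_heatFun hτ hq hA).cesaro_mem_LInfty
    rw [e] at h2
    simp only [e] at h1
    exact ⟨h1, h2⟩
  · obtain ⟨ψ, hψ, hinv, hψγ⟩ := HeatKernel.exists_dilationInvariant γ hγ
    have key : ∀ A ∈ HeatKernel.dixmierIdeal N τ,
        (HeatKernel.xi τ q γ A).re = (HeatKernel.xi τ q (ψ ∘ₗ HeatKernel.smooth) A).re := by
      intro A hA
      have hp := HeatKernel.hasLogMean_heatFun hτ hq hA
      have hn := HeatKernel.hasLogMean_heatFun_negPart hτ hq hA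
      have h := hψγ _ (HeatKernel.apply_dilation_sub hτ hq hγ hlin hA)
      rw [map_sub, map_sub] at h
      rw [HeatKernel.xi_re, HeatKernel.xi_re, HeatKernel.xiPos_eq q _ hp,
        HeatKernel.xiPos_eq q _ hn, HeatKernel.xiPos_eq q _ hp, HeatKernel.xiPos_eq q _ hn,
        LinearMap.comp_apply, LinearMap.comp_apply, HeatKernel.apply_smooth_cesaro hψ hinv hp,
        HeatKernel.apply_smooth_cesaro hψ hinv hn]
      exact h.symm
    refine ⟨ψ ∘ₗ HeatKernel.smooth, hψ.comp_smooth, hinv.comp_smooth,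
      HeatKernel.respectsAE_comp_smooth ψ, fun A hA => Complex.ext (key A hA) ?_⟩
    -- The real part of -iA is ℑ A, so the identity of real parts at -iA is that of imaginary parts
    -- at A.
    have h := key _ (HeatKernel.smul_mem_dixmierIdeal hA (-Complex.I))
    have e : ℜ (-Complex.I • A) = ℑ A := by
      rw [neg_smul, map_neg, realPart_I_smul, neg_neg]
    rw [HeatKernel.xi_re, HeatKernel.xi_re, e] at h
    simpa [HeatKernel.xi] using h
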